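/- Let $K$ be a field of characteristic $0$. \emph{Setting.} A complete filtered associative algebra (resp. Lie algebra) over $K$ is an associative algebra, not necessarily unital (resp. a Lie algebra), $A$ with a decreasing filtration $A=A_0\supseteq A_1\supseteq A_2\supseteq\cdots$ by subspaces such that $A_mA_n\subseteq A_{m+n}$ (resp. $[A_m,A_n]\subseteq A_{m+n}$) for all $m,n\ge 0$ and such that the canonical map $A\to\varprojlim A/A_n$ is bijective. Limits and infinite sums are taken in the topology defined by the filtration. If $A$ is associative, let $B$ be any unital associative $K$-algebra containing $A$ as a subalgebra (for instance $B=A$ if $A$ is unital, or $A$ with a unit adjoined), and for $a\in A_1$ put $$\exp(a)=1+\sum_{n\ge1}\frac{a^n}{n!}\in 1+A_1\subseteq B,\qquad \log(1+a)=-\sum_{n\ge1}\frac{(-a)^n}{n}\in A_1 .$$ If $A$ is a Lie algebra, let $U_n$ be the two-sided ideal of the universal enveloping algebra $U(A)$ generated by the products $x_1\cdots x_k$ with $k \ge 0$, $x_i\in A_{n_i}$ and $n_1+\dots+n_k\ge n$, and let $\hat U=\varprojlim U(A)/U_n$, filtered by the kernels $\hat U_n$ of $\hat U\to U(A)/U_n$;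 for $x,y\in A_1$, $\exp(x)$ and $\log(\exp(x)\exp(y))$ are computed by the same series in $\hat U$ from the images of $x,y$ under the canonical map $A\to\hat U$, and for such $x,y$ an element of $A_1$ is identified with its image in $\hat U$. In both cases, for $x,y\in A_1$, let $C(x,y)=\log(\exp(x)\exp(y))$ and $\mathrm{BCH}(x,y)=C(x,y)-x-y$. For a filtration-preserving linear map $P:A\to A$ (that is, $P(A_n)\subseteq A_n$ for all $n$), put $\tilde P=\mathrm{id}_A-P$ and $\chi(a)=\lim_{n\to\infty}\chi_{(n)}(a)$ for $a\in A_1$, where $$\chi_{(0)}(a)=a,\qquad \chi_{(n+1)}(a)=a-\mathrm{BCH}\bigl(P(\chi_{(n)}(a)),\tilde P(\chi_{(n)}(a))\bigr).$$ Let $\tilde\chi$ be the map obtained in the same way from $\tilde P$ in place of $P$. \textbf{Theorem.} Let $A$ be a complete filtered associative algebra or a complete filtered Lie algebra over $K$, and let $P:A\to A$ be a linear map with $P\circ P=P$ that preserves the filtration. Put $A_{1,-}=P(A_1)$ and $A_{1,+}=\tilde P(A_1)$. Then $C$ is a well-defined map $A_1\times A_1\to A_1$ with $\exp(C(x,y))=\exp(x)\exp(y)$,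 the limits defining $\chi$ and $\tilde\chi$ exist, $\chi$ and $\tilde\chi$ are bijections $A_1\to A_1$, and the following hold. (1) (Factorization) $C$ restricts to a bijection $C_-:A_{1,-}\times A_{1,+}\to A_1$. (2) (Formal uniformization) There is a unique bijection $\Psi=(\Psi_-,\Psi_+):A_{1,+}\times A_{1,-}\to A_{1,-}\times A_{1,+}$ such that for all $a=(a_+,a_-)\in A_{1,+}\times A_{1,-}$ $$\exp(a_+)\exp(a_-)=\exp(\Psi_-(a))\exp(\Psi_+(a)).$$ (3) The inverse of $C_-$ is $D_P:a\mapsto\bigl(P(\chi(a)),\tilde P(\chi(a))\bigr)$, $a\in A_1$, and for all $a=(a_+,a_-)\in A_{1,+}\times A_{1,-}$ $$\Psi(a)=\bigl(P(\chi(C(a_+,a_-))),\ \tilde P(\chi(C(a_+,a_-)))\bigr)=\bigl(P(\chi(\tilde\chi^{-1}(a_++a_-))),\ \tilde P(\chi(\tilde\chi^{-1}(a_++a_-)))\bigr).$$ -/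

import Mathlib

/-!
Complete filtered algebras, the exponential and logarithm series, the
Baker--Campbell--Hausdorff map `C(x,y) = log (exp x exp y)` and the BCH-recursion `χ`,
both for associative algebras and for Lie algebras.
-/

namespace BCHFactorization

universe u v w

section Filtration

variable {K : Type u} {M : Type v} [Field K] [AddCommGroup M] [Module K M]

/-- A decreasing filtration `M = F 0 ⊇ F 1 ⊇ F 2 ⊇ ⋯` by subspaces, for which the canonical map
`M → lim M / F n` is bijective.  A point of the inverse limit is given by representatives
`x n : M` of its components in `M / F n`. -/
structure IsCompleteFiltration (F : ℕ → Submodule K M) : Prop where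
  zero_eq_top : F 0 = ⊤
  antitone : Antitone F
  complete : ∀ x : ℕ → M, (∀ n, x (n + 1) - x n ∈ F n) → ∃! a : M, ∀ n, a - x n ∈ F n

/-- The sequence `x` converges to `a` in the topology given by the filtration `F`. -/
def ConvergesTo (F : ℕ → Submodule K M) (x : ℕ → M) (a : M) : Prop :=
  ∀ n, ∃ N, ∀ k, N ≤ k → x k - a ∈ F n

open Classical in
/-- The limit of a sequence in the topology given by the filtration (`0` if there is none). -/
noncomputable def filtLim (F : ℕ → Submodule K M) (x : ℕ → M) : M :=
  if h : ∃ a, ConvergesTo F x a then h.choose else 0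

end Filtration

section Recursion

variable {K : Type u} {M : Type v} [Field K] [AddCommGroup M] [Module K M]

/-- The complementary map `P̃ = id - P`. -/
def tilde (P : M →ₗ[K] M) : M →ₗ[K] M := LinearMap.id - P

/-- `BCH(x,y) = C(x,y) - x - y`. -/
def bch (C : M → M → M) (x y : M) : M := C x y - x - y

/-- The BCH-recursion `χ₍₀₎(a) = a`, `χ₍ₙ₊₁₎(a) = a - BCH(P(χ₍ₙ₎(a)), P̃(χ₍ₙ₎(a)))`. -/
def chiSeq (P : M →ₗ[K] M) (C : M → M → M) (a : M) : ℕ → M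
  | 0 => a
  | n + 1 => a - bch C (P (chiSeq P C a n)) (tilde P (chiSeq P C a n))

/-- The map `χ(a) = lim χ₍ₙ₎(a)` associated with `P`. -/
noncomputable def chi (F : ℕ → Submodule K M) (P : M →ₗ[K] M) (C : M → M → M) (a : M) : M :=
  filtLim F (chiSeq P C a)

end Recursion

section Associative

variable {K : Type u} {A : Type v} [Field K] [NonUnitalRing A] [Module K A]

/-- A complete filtered associative algebra (possibly without unit). -/
structure IsCompleteFilteredAlgebra (F : ℕ → Submodule K A) : Prop
    extends IsCompleteFiltration F where
  mul_mem : ∀ m n : ℕ, ∀ a ∈ F m, ∀ b ∈ F n, a * b ∈ F (m + n)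

/-- `powSucc a n = a ^ (n + 1)`, in an algebra which need not have a unit. -/
def powSucc (a : A) : ℕ → A
  | 0 => a
  | n + 1 => powSucc a n * a

/-- `exp(a) - 1 = ∑_{n ≥ 1} aⁿ / n!`. -/
noncomputable def expSubOne (F : ℕ → Submodule K A) (a : A) : A :=
  filtLim F fun N => ∑ k ∈ Finset.range N, ((k + 1).factorial : K)⁻¹ • powSucc a k

/-- `log(1 + a) = -∑_{n ≥ 1} (-a)ⁿ / n`. -/
noncomputable def logOneAdd (F : ℕ → Submodule K A) (a : A) : A :=
  filtLim F fun N => -∑ k ∈ Finset.range N, ((k + 1 : ℕ) : K)⁻¹ • powSucc (-a) k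

/-- `C(x,y) = log(exp(x) exp(y))`; here `exp(x) exp(y) = 1 + (a + b + a b)` for
`exp(x) = 1 + a` and `exp(y) = 1 + b`. -/
noncomputable def hausdorff (F : ℕ → Submodule K A) (x y : A) : A :=
  logOneAdd F (expSubOne F x + expSubOne F y + expSubOne F x * expSubOne F y)

/-- `exp(a) = 1 + ∑_{n ≥ 1} aⁿ / n!`, as an element of a unital algebra `B` that contains `A`
by means of `j`. -/
noncomputable def expIn {B : Type w} [Ring B] [Algebra K B] (F : ℕ → Submodule K A)
    (j : A →ₙₐ[K] B) (a : A) : B :=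
  1 + j (expSubOne F a)

end Associative

section LieAlgebras

variable {K : Type u} {L : Type v} [Field K] [LieRing L] [LieAlgebra K L]

/-- A complete filtered Lie algebra. -/
structure IsCompleteFilteredLieAlgebra (F : ℕ → Submodule K L) : Prop
    extends IsCompleteFiltration F where
  lie_mem : ∀ m n : ℕ, ∀ a ∈ F m, ∀ b ∈ F n, ⁅a, b⁆ ∈ F (m + n)

/-- The products `x₁ ⋯ x_k` in the universal enveloping algebra, with `x_i ∈ F n_i` and
`n₁ + ⋯ + n_k ≥ n`.  An element of the list is a pair `(n_i, x_i)`. -/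
def weightedProducts (F : ℕ → Submodule K L) (n : ℕ) : Set (UniversalEnvelopingAlgebra K L) :=
  {z | ∃ l : List (ℕ × L), (∀ p ∈ l, p.2 ∈ F p.1) ∧ n ≤ (l.map Prod.fst).sum ∧
    z = (l.map fun p => UniversalEnvelopingAlgebra.ι K p.2).prod}

/-- The filtration on the universal enveloping algebra induced by a filtration `F` on the Lie
algebra: the `n`-th step is the two-sided ideal generated by the products of total
weight at least `n`. -/
def envelopingFiltration (F : ℕ → Submodule K L) (n : ℕ) :
    Ideal (UniversalEnvelopingAlgebra K L) :=
  (TwoSidedIdeal.span (weightedProducts F n)).asIdeal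

instance (F : ℕ → Submodule K L) (n : ℕ) : (envelopingFiltration F n).IsTwoSided :=
  inferInstanceAs ((TwoSidedIdeal.span (weightedProducts F n)).asIdeal.IsTwoSided)

theorem envelopingFiltration_antitone (F : ℕ → Submodule K L) :
    Antitone (envelopingFiltration F) := by
  intro m n h
  apply TwoSidedIdeal.asIdeal.monotone
  apply TwoSidedIdeal.span_mono
  rintro z ⟨l, h1, h2, h3⟩
  exact ⟨l, h1, h.trans h2, h3⟩

/-- The completed universal enveloping algebra `lim U(L) / U(L)_n`, as the algebra of compatible
families in `∏ U(L) / U(L)_n`. -/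
def completedEnveloping (F : ℕ → Submodule K L) :
    Subalgebra K (∀ n, UniversalEnvelopingAlgebra K L ⧸ envelopingFiltration F n) where
  carrier := {f | ∀ m n (h : m ≤ n),
    Ideal.Quotient.factorₐ K (envelopingFiltration_antitone F h) (f n) = f m}
  mul_mem' := fun {a b} ha hb m n h => by
    rw [Pi.mul_apply, Pi.mul_apply, map_mul, ha m n h, hb m n h]
  add_mem' := fun {a b} ha hb m n h => by
    rw [Pi.add_apply, Pi.add_apply, map_add, ha m n h, hb m n h]
  algebraMap_mem' := fun r m n h => by
    rw [Pi.algebraMap_apply, Pi.algebraMap_apply, AlgHom.commutes]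

/-- The filtration of the completed enveloping algebra: the `n`-th step is the kernel of the
projection to `U(L) / U(L)_n`. -/
def completedFiltration (F : ℕ → Submodule K L) (n : ℕ) : Submodule K (completedEnveloping F) where
  carrier := {f | f.1 n = 0}
  zero_mem' := rfl
  add_mem' := fun {a b} (ha : a.1 n = 0) (hb : b.1 n = 0) => by
    change a.1 n + b.1 n = 0
    rw [ha, hb, add_zero]
  smul_mem' := fun c a (ha : a.1 n = 0) => by
    change c • a.1 n = 0
    rw [ha, smul_zero]

/-- The canonical map from a filtered Lie algebra to its completed enveloping algebra. -/
def toCompleted (F : ℕ → Submodule K L) (x : L) : completedEnveloping F :=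
  ⟨fun n => Ideal.Quotient.mkₐ K (envelopingFiltration F n) (UniversalEnvelopingAlgebra.ι K x),
    fun _ _ _ => rfl⟩

/-- The exponential of an element of a complete filtered Lie algebra, in the completed
enveloping algebra. -/
noncomputable def lieExp (F : ℕ → Submodule K L) (x : L) : completedEnveloping F :=
  1 + expSubOne (completedFiltration F) (toCompleted F x)

open Classical in
/-- `C(x,y)` for a complete filtered Lie algebra `L`: the element of `F 1` whose image in the
completed enveloping algebra is `log(exp(x) exp(y))` (`0` if there is none). -/
noncomputable def lieHausdorff (F : ℕ → Submodule K L) (x y : L) : L :=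
  if h : ∃ z ∈ F 1, toCompleted F z =
      hausdorff (completedFiltration F) (toCompleted F x) (toCompleted F y)
  then h.choose else 0

end LieAlgebras

section Conclusion

variable {K : Type u} {M : Type v} {B : Type w} [Field K] [AddCommGroup M] [Module K M] [Mul B]

/-- The assertion of the factorization and formal uniformization theorem, for a filtration `F` of
`M`, a linear map `P`, the map `C` and the exponential `e`.  Here `M₁ = F 1`, `P̃ = id - P`,
`M₁₋ = P(M₁)`, `M₁₊ = P̃(M₁)`, and `χ`, `χ̃` are the BCH-recursion maps of `P`, `P̃`. -/
structure FactorizationAndUniformization (F : ℕ → Submodule K M) (P : M →ₗ[K] M)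
    (C : M → M → M) (e : M → B) : Prop where
  /-- `C` is a map `M₁ × M₁ → M₁` with `exp(C(x,y)) = exp(x) exp(y)`. -/
  hausdorff_spec : ∀ x ∈ F 1, ∀ y ∈ F 1, C x y ∈ F 1 ∧ e (C x y) = e x * e y
  /-- The recursion defining `χ` converges. -/
  chi_converges : ∀ a ∈ F 1, ConvergesTo F (chiSeq P C a) (chi F P C a)
  /-- The recursion defining `χ̃` converges. -/
  chi_tilde_converges : ∀ a ∈ F 1, ConvergesTo F (chiSeq (tilde P) C a)
    (chi F (tilde P) C a)
  /-- `χ : M₁ → M₁` is a bijection. -/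
  chi_bijOn : Set.BijOn (chi F P C) (F 1) (F 1)
  /-- `χ̃ : M₁ → M₁` is a bijection. -/
  chi_tilde_bijOn : Set.BijOn (chi F (tilde P) C) (F 1) (F 1)
  /-- Factorization: `C` restricts to a bijection `M₁₋ × M₁₊ → M₁`. -/
  factorization : Set.BijOn (fun p : M × M => C p.1 p.2)
    (((F 1).map P : Set M) ×ˢ ((F 1).map (tilde P) : Set M)) (F 1)
  /-- The inverse of that bijection is `D_P = (P ∘ χ, P̃ ∘ χ)`. -/
  factorization_inverse : Set.InvOn
    (fun a : M => (P (chi F P C a), tilde P (chi F P C a)))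
    (fun p : M × M => C p.1 p.2)
    (((F 1).map P : Set M) ×ˢ ((F 1).map (tilde P) : Set M)) (F 1)
  /-- Uniformization: there is a unique bijection `Ψ : M₁₊ × M₁₋ → M₁₋ × M₁₊` with
  `exp(a₊) exp(a₋) = exp(Ψ₋(a)) exp(Ψ₊(a))`. -/
  uniformization :
    ∃! Ψ : ((F 1).map (tilde P) × (F 1).map P) ≃
        ((F 1).map P × (F 1).map (tilde P)),
      ∀ a, e (a.1 : M) * e (a.2 : M) = e ((Ψ a).1 : M) * e ((Ψ a).2 : M)
  /-- This `Ψ` satisfies `Ψ(a) = (P(χ(C(a))), P̃(χ(C(a))))` and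
  `Ψ(a) = (P(χ(χ̃⁻¹(a₊ + a₋))), P̃(χ(χ̃⁻¹(a₊ + a₋))))`. -/
  uniformization_formula :
    ∀ Ψ : ((F 1).map (tilde P) × (F 1).map P) ≃
        ((F 1).map P × (F 1).map (tilde P)),
      (∀ a, e (a.1 : M) * e (a.2 : M) = e ((Ψ a).1 : M) * e ((Ψ a).2 : M)) →
      ∀ a,
        (((Ψ a).1 : M) = P (chi F P C (C (a.1 : M) (a.2 : M))) ∧
          ((Ψ a).2 : M) = tilde P (chi F P C (C (a.1 : M) (a.2 : M)))) ∧
        (((Ψ a).1 : M) = P (chi F P C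
            (Function.invFunOn (chi F (tilde P) C) (F 1) ((a.1 : M) + (a.2 : M)))) ∧
          ((Ψ a).2 : M) = tilde P (chi F P C
            (Function.invFunOn (chi F (tilde P) C) (F 1) ((a.1 : M) + (a.2 : M)))))

end Conclusion

end BCHFactorization

namespace BCHFactorization

universe u v w

/-! ### Contractions on a complete filtration and the BCH recursion -/

section Filtration

variable {K : Type u} {M : Type v} [Field K] [AddCommGroup M] [Module K M]
  {F : ℕ → Submodule K M}

/-! Both cases rest on one property of `C`: it preserves `F 1`, and `bch C` moves differences one
step deeper into the filtration (`IsContractingProduct`). Then `C (P c) (tilde P c) = a` is the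
fixed-point equation `c = a - bch C (P c) (tilde P c)` of a contraction. The recursion converges to
its unique solution in `F 1`, so `chi` inverts `c ↦ C (P c) (tilde P c)` (`hausdorff_chi`,
`chi_hausdorff`). As `P` is idempotent, `c ↦ (P c, tilde P c)` identifies `F 1` with the product of
its two images, which gives the factorization. Ψ is `C` on the factors in the opposite order,
followed by the inverse of the factorization; injectivity of the exponential leaves no other choice.

For associative algebras the contraction property holds because exp - 1 and log(1 + ·) are the
identity to first order. They are mutually inverse by a polynomial identity, proved from a
differential equation.

For a Lie algebra `L` two facts are needed: log(exp x exp y) comes from `L`, and the filtration of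
`L` is induced from that of U(L). Both come from one function on words, `logWords`, the multilinear
part of log(exp x₁ ⋯ exp xₙ). It is the solution `z` of ((1 - exp(-ad z)) / ad z) ∂ₓz = x, where ∂ₓ
is `shift x`, in a Lie algebra of `L`-valued functions on words; so its values lie in `L` by
construction.

The Maurer-Cartan equation and the invertibility of (1 - exp(-ad z)) / ad z show that the shifts of
`logWords` obey the relations of `L`. Hence `logWords` descends to a linear retraction
`envelopingProj` of U(L) onto `L` which respects weights. This gives the second fact, without the
Poincaré-Birkhoff-Witt theorem. Over U(L) the same differential equation says that exp(`logWords`)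
is the function sending a word to the product of its letters. Evaluation at the group-like element
exp x exp y is multiplicative, so it turns this identity into the first fact. -/

theorem IsCompleteFiltration.eq_zero_of_forall_mem (hF : IsCompleteFiltration F) {a : M}
    (ha : ∀ n, a ∈ F n) : a = 0 := by
  obtain ⟨b, -, hb⟩ := hF.complete (fun _ => 0) (fun n => by simp)
  rw [hb a (fun n => by simpa using ha n), hb 0 (fun n => by simp)]

theorem IsCompleteFiltration.eq_of_forall_sub_mem (hF : IsCompleteFiltration F) {a b : M}
    (h : ∀ n, a - b ∈ F n) : a = b :=
  sub_eq_zero.1 (hF.eq_zero_of_forall_mem h)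

theorem ConvergesTo.unique (hF : IsCompleteFiltration F) {x : ℕ → M} {a b : M}
    (ha : ConvergesTo F x a) (hb : ConvergesTo F x b) : a = b := by
  refine hF.eq_of_forall_sub_mem fun n => ?_
  obtain ⟨N, hN⟩ := ha n
  obtain ⟨N', hN'⟩ := hb n
  have h := (F n).sub_mem (hN' _ (le_max_right N N')) (hN _ (le_max_left N N'))
  rwa [sub_sub_sub_cancel_left] at h

theorem ConvergesTo.filtLim_eq (hF : IsCompleteFiltration F) {x : ℕ → M} {a : M}
    (ha : ConvergesTo F x a) : filtLim F x = a := by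
  have h : ∃ a, ConvergesTo F x a := ⟨a, ha⟩
  rw [filtLim, dif_pos h]
  exact h.choose_spec.unique hF ha

theorem convergesTo_of_sub_mem (hF : Antitone F) {x : ℕ → M} {a : M}
    (h : ∀ n, a - x n ∈ F n) : ConvergesTo F x a := fun n =>
  ⟨n, fun k hk => by rw [← neg_sub]; exact (F n).neg_mem (hF hk (h k))⟩

/-- A sequence whose increments tend to zero at the given rate converges to `filtLim`, at the
same rate. -/
theorem IsCompleteFiltration.filtLim_sub_mem (hF : IsCompleteFiltration F) {x : ℕ → M}
    (hx : ∀ n, x (n + 1) - x n ∈ F n) (n : ℕ) : filtLim F x - x n ∈ F n := by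
  obtain ⟨a, ha, -⟩ := hF.complete x hx
  rw [(convergesTo_of_sub_mem hF.antitone ha).filtLim_eq hF]
  exact ha n

theorem IsCompleteFiltration.convergesTo_filtLim (hF : IsCompleteFiltration F) {x : ℕ → M}
    (hx : ∀ n, x (n + 1) - x n ∈ F n) : ConvergesTo F x (filtLim F x) :=
  convergesTo_of_sub_mem hF.antitone (hF.filtLim_sub_mem hx)

theorem tilde_apply (P : M →ₗ[K] M) (a : M) : tilde P a = a - P a := rfl

theorem tilde_tilde (P : M →ₗ[K] M) : tilde (tilde P) = P := sub_sub_cancel _ _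

theorem tilde_mem {P : M →ₗ[K] M} (hP : ∀ n, ∀ a ∈ F n, P a ∈ F n) (n : ℕ) (a : M)
    (ha : a ∈ F n) : tilde P a ∈ F n :=
  (F n).sub_mem ha (hP n a ha)

theorem add_tilde (P : M →ₗ[K] M) (a : M) : P a + tilde P a = a := by
  rw [tilde_apply, add_sub_cancel]

/-- The map `C` takes values in `F 1`, and `BCH(x,y)` is contracting in `x` and `y`. -/
structure IsContractingProduct (F : ℕ → Submodule K M) (C : M → M → M) : Prop where
  mem : ∀ x ∈ F 1, ∀ y ∈ F 1, C x y ∈ F 1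
  bch_sub_mem : ∀ n, ∀ x ∈ F 1, ∀ x' ∈ F 1, ∀ y ∈ F 1, ∀ y' ∈ F 1,
    x - x' ∈ F n → y - y' ∈ F n → bch C x y - bch C x' y' ∈ F (n + 1)

section Chi

variable {P : M →ₗ[K] M} {C : M → M → M}

theorem IsContractingProduct.bch_mem (hC : IsContractingProduct F C) {x y : M} (hx : x ∈ F 1)
    (hy : y ∈ F 1) : bch C x y ∈ F 1 :=
  (F 1).sub_mem ((F 1).sub_mem (hC.mem x hx y hy) hx) hy

theorem IsContractingProduct.bch_sub_bch_mem (hC : IsContractingProduct F C)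
    (hP : ∀ n, ∀ a ∈ F n, P a ∈ F n) (n : ℕ) {a b : M} (ha : a ∈ F 1) (hb : b ∈ F 1)
    (h : a - b ∈ F n) : bch C (P a) (tilde P a) - bch C (P b) (tilde P b) ∈ F (n + 1) :=
  hC.bch_sub_mem n _ (hP 1 a ha) _ (hP 1 b hb) _ (tilde_mem hP 1 a ha) _ (tilde_mem hP 1 b hb)
    (by rw [← map_sub]; exact hP n _ h) (by rw [← map_sub]; exact tilde_mem hP n _ h)

theorem chiSeq_mem (hC : IsContractingProduct F C) (hP : ∀ n, ∀ a ∈ F n, P a ∈ F n) {a : M}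
    (ha : a ∈ F 1) (n : ℕ) : chiSeq P C a n ∈ F 1 := by
  induction n with
  | zero => exact ha
  | succ n ih => exact (F 1).sub_mem ha (hC.bch_mem (hP 1 _ ih) (tilde_mem hP 1 _ ih))

/-- The first increment is unconstrained since `F 0` is everything; the contraction then gains one
degree at each iteration. -/
theorem chiSeq_succ_sub_mem (hF : IsCompleteFiltration F) (hC : IsContractingProduct F C)
    (hP : ∀ n, ∀ a ∈ F n, P a ∈ F n) {a : M} (ha : a ∈ F 1) (n : ℕ) :
    chiSeq P C a (n + 1) - chiSeq P C a n ∈ F n := by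
  induction n with
  | zero => rw [hF.zero_eq_top]; trivial
  | succ n ih =>
    have h := hC.bch_sub_bch_mem hP n (chiSeq_mem hC hP ha (n + 1)) (chiSeq_mem hC hP ha n) ih
    rw [← Submodule.neg_mem_iff] at h
    convert h using 1
    simp only [chiSeq]
    abel

theorem chi_convergesTo (hF : IsCompleteFiltration F) (hC : IsContractingProduct F C)
    (hP : ∀ n, ∀ a ∈ F n, P a ∈ F n) {a : M} (ha : a ∈ F 1) :
    ConvergesTo F (chiSeq P C a) (chi F P C a) :=
  hF.convergesTo_filtLim (chiSeq_succ_sub_mem hF hC hP ha)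

theorem chi_mem (hF : IsCompleteFiltration F) (hC : IsContractingProduct F C)
    (hP : ∀ n, ∀ a ∈ F n, P a ∈ F n) {a : M} (ha : a ∈ F 1) : chi F P C a ∈ F 1 := by
  have h := hF.filtLim_sub_mem (chiSeq_succ_sub_mem hF hC hP ha) 1
  exact ((F 1).sub_mem_iff_left (chiSeq_mem hC hP ha 1)).1 h

/-- Passing to the limit in the recursion gives `c = a - bch C (P c) (tilde P c)`. The linear terms
of `bch` add up to `c`, so they cancel and the equation for `C` remains. -/
theorem hausdorff_chi (hF : IsCompleteFiltration F) (hC : IsContractingProduct F C)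
    (hP : ∀ n, ∀ a ∈ F n, P a ∈ F n) {a : M} (ha : a ∈ F 1) :
    C (P (chi F P C a)) (tilde P (chi F P C a)) = a := by
  set c := chi F P C a with hc
  have hcm : c ∈ F 1 := chi_mem hF hC hP ha
  have key : c = a - bch C (P c) (tilde P c) := by
    refine hF.eq_of_forall_sub_mem fun n => ?_
    have h1 := hF.filtLim_sub_mem (chiSeq_succ_sub_mem hF hC hP ha) (n + 1)
    have h2 := hF.filtLim_sub_mem (chiSeq_succ_sub_mem hF hC hP ha) n
    have h3 := hC.bch_sub_bch_mem hP n hcm (chiSeq_mem hC hP ha n) h2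
    have h4 := hF.antitone (Nat.le_succ n) ((F (n + 1)).add_mem h1 h3)
    convert h4 using 1
    simp only [chiSeq, hc, chi]
    abel
  have h5 := add_tilde P c
  rw [bch] at key
  have h6 : C (P c) (tilde P c) - (P c + tilde P c) = a - c := by
    nth_rewrite 5 [key]
    abel
  rw [h5] at h6
  exact sub_left_injective h6

/-- When the values of `C` agree, `a - b` is minus the difference of the BCH terms, so `a - b ∈ F n`
improves to `F (n + 1)`. -/
theorem eq_of_hausdorff_eq (hF : IsCompleteFiltration F) (hC : IsContractingProduct F C)
    (hP : ∀ n, ∀ a ∈ F n, P a ∈ F n) {a b : M} (ha : a ∈ F 1) (hb : b ∈ F 1)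
    (h : C (P a) (tilde P a) = C (P b) (tilde P b)) : a = b := by
  refine hF.eq_of_forall_sub_mem fun n => ?_
  induction n with
  | zero => rw [hF.zero_eq_top]; trivial
  | succ n ih =>
    have h1 := hC.bch_sub_bch_mem hP n ha hb ih
    rw [← Submodule.neg_mem_iff] at h1
    convert h1 using 1
    nth_rewrite 1 [← add_tilde P a, ← add_tilde P b]
    rw [bch, bch, h]
    abel

theorem chi_hausdorff (hF : IsCompleteFiltration F) (hC : IsContractingProduct F C)
    (hP : ∀ n, ∀ a ∈ F n, P a ∈ F n) {c : M} (hc : c ∈ F 1) :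
    chi F P C (C (P c) (tilde P c)) = c := by
  have hm := hC.mem _ (hP 1 c hc) _ (tilde_mem hP 1 c hc)
  exact eq_of_hausdorff_eq hF hC hP (chi_mem hF hC hP hm) hc (hausdorff_chi hF hC hP hm)

theorem chi_bijOn (hF : IsCompleteFiltration F) (hC : IsContractingProduct F C)
    (hP : ∀ n, ∀ a ∈ F n, P a ∈ F n) : Set.BijOn (chi F P C) (F 1) (F 1) := by
  refine Set.InvOn.bijOn (f' := fun c => C (P c) (tilde P c))
    ⟨fun a ha => hausdorff_chi hF hC hP ha, fun c hc => chi_hausdorff hF hC hP hc⟩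
    (fun a ha => chi_mem hF hC hP ha)
    (fun c hc => hC.mem _ (hP 1 c hc) _ (tilde_mem hP 1 c hc))

section Idempotent

variable (hPP : P ∘ₗ P = P)
include hPP

theorem tilde_comp_tilde : tilde P ∘ₗ tilde P = tilde P := by
  ext a
  have h : P (P a) = P a := LinearMap.congr_fun hPP a
  simp [tilde_apply, h]

/-- On `P(F₁) × P̃(F₁)`, the pair `(P, P̃)` recovers the summands of `p + q`. -/
theorem apply_add_of_mem_map {n : ℕ} {p q : M} (hp : p ∈ (F n).map P)
    (hq : q ∈ (F n).map (tilde P)) : P (p + q) = p ∧ tilde P (p + q) = q := by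
  obtain ⟨a, -, rfl⟩ := hp
  obtain ⟨b, -, rfl⟩ := hq
  have ha : P (P a) = P a := LinearMap.congr_fun hPP a
  have hb : P (P b) = P b := LinearMap.congr_fun hPP b
  simp [tilde_apply, ha, hb]

theorem factorization_invOn (hF : IsCompleteFiltration F) (hC : IsContractingProduct F C)
    (hP : ∀ n, ∀ a ∈ F n, P a ∈ F n) :
    Set.InvOn (fun a : M => (P (chi F P C a), tilde P (chi F P C a)))
      (fun p : M × M => C p.1 p.2)
      (((F 1).map P : Set M) ×ˢ ((F 1).map (tilde P) : Set M)) (F 1) := by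
  refine ⟨?_, fun a ha => hausdorff_chi hF hC hP ha⟩
  rintro ⟨p, q⟩ ⟨hp, hq⟩
  obtain ⟨h1, h2⟩ := apply_add_of_mem_map hPP hp hq
  have hpq : p + q ∈ F 1 := by
    obtain ⟨a, ha, rfl⟩ := hp
    obtain ⟨b, hb, rfl⟩ := hq
    exact (F 1).add_mem (hP 1 a ha) (tilde_mem hP 1 b hb)
  have h := chi_hausdorff hF hC hP hpq
  rw [h1, h2] at h
  simp only [h, h1, h2]

theorem factorization_bijOn (hF : IsCompleteFiltration F) (hC : IsContractingProduct F C)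
    (hP : ∀ n, ∀ a ∈ F n, P a ∈ F n) :
    Set.BijOn (fun p : M × M => C p.1 p.2)
      (((F 1).map P : Set M) ×ˢ ((F 1).map (tilde P) : Set M)) (F 1) := by
  refine (factorization_invOn hPP hF hC hP).bijOn ?_ fun a ha =>
    ⟨⟨_, chi_mem hF hC hP ha, rfl⟩, ⟨_, chi_mem hF hC hP ha, rfl⟩⟩
  rintro ⟨p, q⟩ ⟨⟨a, ha, rfl⟩, ⟨b, hb, rfl⟩⟩
  exact hC.mem _ (hP 1 a ha) _ (tilde_mem hP 1 b hb)

/-- Only multiplicativity and injectivity of `e` on `F 1` enter: they turn the defining equation of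
Ψ into `C (a₊, a₋) = C (Ψ₋, Ψ₊)`, which the inverse of the factorization solves uniquely. -/
theorem factorizationAndUniformization_of_isContractingProduct {B : Type w} [Mul B]
    (hF : IsCompleteFiltration F) (hC : IsContractingProduct F C)
    (hP : ∀ n, ∀ a ∈ F n, P a ∈ F n) {e : M → B} (he : Set.InjOn e (F 1))
    (heC : ∀ x ∈ F 1, ∀ y ∈ F 1, e (C x y) = e x * e y) :
    FactorizationAndUniformization F P C e := by
  have hQ := tilde_mem hP
  have hPm : ∀ p : (F 1).map P, (p : M) ∈ F 1 := by
    rintro ⟨_, a, ha, rfl⟩; exact hP 1 a ha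
  have hQm : ∀ p : (F 1).map (tilde P), (p : M) ∈ F 1 := by
    rintro ⟨_, a, ha, rfl⟩; exact hQ 1 a ha
  have hQQ := tilde_comp_tilde hPP
  have inv := factorization_invOn hPP hF hC hP
  have bij' := factorization_bijOn hQQ hF hC hQ
  -- The same factorization with `P` and `tilde P` exchanged inverts `C` on the factors in the
  -- opposite order; it supplies the inverse of Ψ.
  have inv' := factorization_invOn hQQ hF hC hQ
  rw [tilde_tilde] at bij' inv'
  have unique : ∀ Ψ : ((F 1).map (tilde P) × (F 1).map P) ≃
      ((F 1).map P × (F 1).map (tilde P)),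
      (∀ a, e (a.1 : M) * e (a.2 : M) = e ((Ψ a).1 : M) * e ((Ψ a).2 : M)) → ∀ a,
      ((Ψ a).1 : M) = P (chi F P C (C (a.1 : M) (a.2 : M))) ∧
        ((Ψ a).2 : M) = tilde P (chi F P C (C (a.1 : M) (a.2 : M))) := by
    intro Ψ hΨ a
    have h := hΨ a
    rw [← heC _ (hQm _) _ (hPm _), ← heC _ (hPm _) _ (hQm _)] at h
    have h1 := he (hC.mem _ (hQm _) _ (hPm _)) (hC.mem _ (hPm _) _ (hQm _)) h
    have h2 := inv.1 (x := (((Ψ a).1 : M), ((Ψ a).2 : M))) ⟨(Ψ a).1.2, (Ψ a).2.2⟩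
    simp only [← h1, Prod.mk.injEq] at h2
    exact ⟨h2.1.symm, h2.2.symm⟩
  refine ⟨fun x hx y hy => ⟨hC.mem x hx y hy, heC x hx y hy⟩,
    fun a ha => chi_convergesTo hF hC hP ha, fun a ha => chi_convergesTo hF hC hQ ha,
    chi_bijOn hF hC hP, chi_bijOn hF hC hQ, factorization_bijOn hPP hF hC hP, inv, ?_, ?_⟩
  · have hm : ∀ a : (F 1).map (tilde P) × (F 1).map P, C (a.1 : M) (a.2 : M) ∈ F 1 :=
      fun a => hC.mem _ (hQm _) _ (hPm _)
    have hm' : ∀ a : (F 1).map P × (F 1).map (tilde P), C (a.1 : M) (a.2 : M) ∈ F 1 :=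
      fun a => hC.mem _ (hPm _) _ (hQm _)
    let Ψ : ((F 1).map (tilde P) × (F 1).map P) ≃ ((F 1).map P × (F 1).map (tilde P)) :=
      { toFun := fun a => (⟨P (chi F P C (C (a.1 : M) (a.2 : M))), _, chi_mem hF hC hP (hm a), rfl⟩,
          ⟨tilde P (chi F P C (C (a.1 : M) (a.2 : M))), _, chi_mem hF hC hP (hm a), rfl⟩)
        invFun := fun a => (⟨tilde P (chi F (tilde P) C (C (a.1 : M) (a.2 : M))), _,
            chi_mem hF hC hQ (hm' a), rfl⟩,
          ⟨P (chi F (tilde P) C (C (a.1 : M) (a.2 : M))), _, chi_mem hF hC hQ (hm' a), rfl⟩)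
        left_inv := fun a => by
          have h := inv'.1 (x := ((a.1 : M), (a.2 : M))) ⟨a.1.2, a.2.2⟩
          simp only [Prod.mk.injEq] at h
          ext <;> simp [hausdorff_chi hF hC hP (hm a), h.1, h.2]
        right_inv := fun a => by
          have h := inv.1 (x := ((a.1 : M), (a.2 : M))) ⟨a.1.2, a.2.2⟩
          simp only [Prod.mk.injEq] at h
          have h' := hausdorff_chi hF hC hQ (hm' a)
          rw [tilde_tilde] at h'
          ext <;> simp [h', h.1, h.2] }
    refine ⟨Ψ, fun a => ?_, fun Ψ' hΨ' => ?_⟩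
    · rw [← heC _ (hQm _) _ (hPm _), ← heC _ (hPm _) _ (hQm _)]
      exact congrArg e (hausdorff_chi hF hC hP (hm a)).symm
    · ext a
      · exact (unique Ψ' hΨ' a).1
      · exact (unique Ψ' hΨ' a).2
  · intro Ψ hΨ a
    refine ⟨unique Ψ hΨ a, ?_⟩
    have hm : C (a.1 : M) (a.2 : M) ∈ F 1 := hC.mem _ (hQm _) _ (hPm _)
    have h : Function.invFunOn (chi F (tilde P) C) (F 1) ((a.1 : M) + (a.2 : M)) =
        C (a.1 : M) (a.2 : M) := by
      -- The sum `a₊ + a₋` has components `a₊` under `tilde P` and `a₋` under `P`, so `C (a₊, a₋)`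
      -- is the element that `χ̃` sends to it.
      have hc : chi F (tilde P) C (C (a.1 : M) (a.2 : M)) = (a.1 : M) + (a.2 : M) := by
        have h := chi_hausdorff hF hC hQ ((F 1).add_mem (hQm a.1) (hPm a.2))
        have h2 : (a.2 : M) ∈ (F 1).map (tilde (tilde P)) := by rw [tilde_tilde]; exact a.2.2
        obtain ⟨e1, e2⟩ := apply_add_of_mem_map hQQ a.1.2 h2
        rwa [e1, e2] at h
      rw [← hc]
      exact (chi_bijOn hF hC hQ).injOn.leftInvOn_invFunOn hm
    rw [h]
    exact unique Ψ hΨ a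

end Idempotent

end Chi

end Filtration

/-! ### The formal identity exp(log(1 + X)) = 1 + X -/

section ExpLogPolynomials

open Polynomial

variable (K : Type u) [Field K] [CharZero K]

/-- The truncation of `exp X - 1` at degree `N`. -/
noncomputable def expPoly (N : ℕ) : K[X] :=
  ∑ k ∈ Finset.range N, C (((k + 1).factorial : K)⁻¹) * X ^ (k + 1)

/-- The truncation of `log (1 + X)` at degree `N`. -/
noncomputable def logPoly (N : ℕ) : K[X] :=
  ∑ k ∈ Finset.range N, C ((-1) ^ k * ((k + 1 : ℕ) : K)⁻¹) * X ^ (k + 1)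

omit [CharZero K] in
theorem X_dvd_logPoly (N : ℕ) : X ∣ logPoly K N :=
  Finset.dvd_sum fun k _ => (dvd_pow_self X k.succ_ne_zero).mul_left _

theorem derivative_expPoly (N : ℕ) :
    derivative (expPoly K N) + C ((N.factorial : K)⁻¹) * X ^ N = 1 + expPoly K N := by
  induction N with
  | zero => simp [expPoly]
  | succ N ih =>
    have h : (((N + 1).factorial : K)⁻¹) * (N + 1 : ℕ) = (N.factorial : K)⁻¹ := by
      rw [Nat.factorial_succ, Nat.cast_mul, mul_inv, mul_right_comm, inv_mul_cancel₀, one_mul]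
      exact Nat.cast_ne_zero.2 N.succ_ne_zero
    rw [expPoly] at ih ⊢
    rw [Finset.sum_range_succ, derivative_add, derivative_C_mul_X_pow, Nat.add_sub_cancel, h,
      ← add_assoc 1, ← ih]

theorem derivative_logPoly (N : ℕ) :
    (1 + X) * derivative (logPoly K N) = 1 - (-X) ^ N := by
  induction N with
  | zero => simp [logPoly]
  | succ N ih =>
    have h : ((-1) ^ N * ((N + 1 : ℕ) : K)⁻¹) * (N + 1 : ℕ) = (-1) ^ N := by
      rw [mul_assoc, inv_mul_cancel₀ (Nat.cast_ne_zero.2 N.succ_ne_zero), mul_one]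
    rw [logPoly] at ih ⊢
    rw [Finset.sum_range_succ, derivative_add, derivative_C_mul_X_pow, Nat.add_sub_cancel, h,
      mul_add, ih, C_pow, C_neg, C_1, neg_pow (X : K[X]), neg_pow (X : K[X]) (N + 1)]
    ring

/-- The composite `p` has no constant term and satisfies `(1 + X) p' = 1 + p` modulo `X ^ N`. In
characteristic zero this determines its coefficients up to degree `N`, and `X` is a solution. -/
theorem X_pow_dvd_expPoly_comp_logPoly_sub_X (N : ℕ) :
    X ^ (N + 1) ∣ (expPoly K N).comp (logPoly K N) - X := by
  set p := (expPoly K N).comp (logPoly K N) with hp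
  have hode : X ^ N ∣ (1 + X) * derivative p - (1 + p) := by
    have h1 := congrArg (fun q => q.comp (logPoly K N)) (derivative_expPoly K N)
    simp only [add_comp, mul_comp, C_comp, X_pow_comp, one_comp] at h1
    have h2 : (1 + X) * derivative p - (1 + p) =
        -(C ((N.factorial : K)⁻¹) * logPoly K N ^ N) -
          (derivative (expPoly K N)).comp (logPoly K N) * (-X) ^ N := by
      rw [hp, derivative_comp, ← h1]
      linear_combination ((derivative (expPoly K N)).comp (logPoly K N)) * derivative_logPoly K N
    rw [h2, neg_pow (X : K[X])]
    exact dvd_sub (((pow_dvd_pow_of_dvd (X_dvd_logPoly K N) N).mul_left _).neg_right)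
      ((dvd_mul_left _ _).mul_left _)
  have h0 : p.coeff 0 = 0 := by
    rw [← X_dvd_iff]
    have h : X ∣ expPoly K N :=
      Finset.dvd_sum fun k _ => (dvd_pow_self X k.succ_ne_zero).mul_left _
    obtain ⟨q, hq⟩ := h
    rw [hp, hq, mul_comp, X_comp]
    exact (X_dvd_logPoly K N).mul_right _
  rw [X_pow_dvd_iff] at hode ⊢
  intro d hd
  induction d with
  | zero => simp [h0]
  | succ d ih =>
    have h := hode d (by omega)
    have hih := ih (by omega)
    have hd0 : ((d : K) + 1) ≠ 0 := by exact_mod_cast d.succ_ne_zero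
    rw [add_mul, one_mul] at h
    rw [coeff_sub] at hih ⊢
    rcases d with _ | d
    · simp only [coeff_sub, coeff_add, coeff_derivative, coeff_one_zero, mul_coeff_zero,
        coeff_X_zero, h0] at h
      simpa [sub_eq_zero] using h
    · simp only [coeff_sub, coeff_add, coeff_derivative, coeff_X_mul, coeff_one] at h
      push_cast at h hd0
      rw [coeff_X, if_neg (by omega), sub_zero]
      -- The equation reads `(d + 2) p_{d+2} = -d p_{d+1}`; the factor `d` kills the one nonzero
      -- coefficient, that of `X`.
      have hih' : p.coeff (d + 1) * d = 0 := by
        rcases d with _ | d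
        · simp
        · rw [coeff_X, if_neg (by omega), sub_zero] at hih
          rw [hih, zero_mul]
      have h' : p.coeff (d + 1 + 1) * ((d : K) + 1 + 1) = 0 := by
        linear_combination h - hih'
      exact (mul_eq_zero.1 h').resolve_right hd0

end ExpLogPolynomials

/-! ### Power series and BCH in complete filtered associative algebras -/

section Associative

variable {K : Type u} {A : Type v} [Field K] [NonUnitalRing A] [Module K A]

theorem powSucc_mem {F : ℕ → Submodule K A} (hF : IsCompleteFilteredAlgebra F) {a : A}
    (ha : a ∈ F 1) (k : ℕ) : powSucc a k ∈ F (k + 1) := by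
  induction k with
  | zero => exact ha
  | succ k ih => exact hF.mul_mem _ _ _ ih _ ha

theorem mul_sub_mul_mem {F : ℕ → Submodule K A} (hF : IsCompleteFilteredAlgebra F)
    {a a' b b' : A} {i j m n : ℕ} (ha : a ∈ F i) (hb' : b' ∈ F j) (haa : a - a' ∈ F m)
    (hbb : b - b' ∈ F n) (h1 : n + i = m + j) : a * b - a' * b' ∈ F (n + i) := by
  have h : a * b - a' * b' = a * (b - b') + (a - a') * b' := by
    rw [mul_sub, sub_mul, sub_add_sub_cancel]
  rw [h]
  refine (F _).add_mem ?_ ?_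
  · rw [add_comm]; exact hF.mul_mem _ _ _ ha _ hbb
  · rw [h1]; exact hF.mul_mem _ _ _ haa _ hb'

theorem powSucc_sub_mem {F : ℕ → Submodule K A} (hF : IsCompleteFilteredAlgebra F) {a b : A}
    (ha : a ∈ F 1) (hb : b ∈ F 1) {n : ℕ} (hab : a - b ∈ F n) (k : ℕ) :
    powSucc a k - powSucc b k ∈ F (n + k) := by
  induction k with
  | zero => exact hab
  | succ k ih =>
    exact mul_sub_mul_mem hF (powSucc_mem hF ha k) hb ih hab (by omega)

/-- The truncation of the power series `∑ c k * a ^ (k + 1)`. -/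
def seriesSum (c : ℕ → K) (a : A) (N : ℕ) : A := ∑ k ∈ Finset.range N, c k • powSucc a k

/-- The power series `∑ c k * a ^ (k + 1)`. -/
noncomputable def seriesLim (F : ℕ → Submodule K A) (c : ℕ → K) (a : A) : A :=
  filtLim F (seriesSum c a)

theorem expSubOne_eq_seriesLim (F : ℕ → Submodule K A) (a : A) :
    expSubOne F a = seriesLim F (fun k => ((k + 1).factorial : K)⁻¹) a := rfl

section Series

variable {F : ℕ → Submodule K A} (hF : IsCompleteFilteredAlgebra F) {a b : A} (c : ℕ → K)
include hF

theorem seriesLim_sub_mem (ha : a ∈ F 1) (N : ℕ) :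
    seriesLim F c a - seriesSum c a N ∈ F (N + 1) := by
  have h : ∀ n, seriesSum c a (n + 1) - seriesSum c a n ∈ F (n + 1) := fun n => by
    rw [seriesSum, seriesSum, Finset.sum_range_succ, add_sub_cancel_left]
    exact (F _).smul_mem _ (powSucc_mem hF ha n)
  have h1 := hF.filtLim_sub_mem (fun n => hF.antitone n.le_succ (h n)) (N + 1)
  simpa [seriesLim] using (F (N + 1)).add_mem h1 (h N)

theorem seriesSum_mem (ha : a ∈ F 1) (N : ℕ) : seriesSum c a N ∈ F 1 :=
  (F 1).sum_mem fun k _ => (F 1).smul_mem _ (hF.antitone (by omega) (powSucc_mem hF ha k))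

theorem seriesLim_mem (ha : a ∈ F 1) : seriesLim F c a ∈ F 1 :=
  ((F 1).sub_mem_iff_left (seriesSum_mem hF c ha 0)).1 (seriesLim_sub_mem hF c ha 0)

/-- In a difference of higher powers at least one further factor from `F 1` accompanies `a - b`, so
only the linear term can remain outside `F (n + 1)`. -/
theorem seriesLim_sub_sub_smul_mem (ha : a ∈ F 1) (hb : b ∈ F 1) {n : ℕ} (hab : a - b ∈ F n) :
    seriesLim F c a - seriesLim F c b - c 0 • (a - b) ∈ F (n + 1) := by
  have h1 := seriesLim_sub_mem hF c ha (n + 1)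
  have h2 := seriesLim_sub_mem hF c hb (n + 1)
  have h3 : seriesSum c a (n + 1) - seriesSum c b (n + 1) - c 0 • (a - b) ∈ F (n + 1) := by
    rw [seriesSum, seriesSum, ← Finset.sum_sub_distrib, Finset.sum_range_succ']
    have : c 0 • powSucc a 0 - c 0 • powSucc b 0 = c 0 • (a - b) := (smul_sub _ _ _).symm
    rw [this, add_sub_cancel_right]
    refine (F _).sum_mem fun k _ => ?_
    rw [← smul_sub]
    exact (F _).smul_mem _ (hF.antitone (by omega) (powSucc_sub_mem hF ha hb hab (k + 1)))
  have h4 := (F (n + 1)).add_mem (hF.antitone (Nat.le_succ _) ((F _).sub_mem h1 h2)) h3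
  convert h4 using 1
  abel

theorem seriesLim_sub_mem_of_sub_mem (ha : a ∈ F 1) (hb : b ∈ F 1) {n : ℕ} (hab : a - b ∈ F n) :
    seriesLim F c a - seriesLim F c b ∈ F n := by
  have h := hF.antitone n.le_succ (seriesLim_sub_sub_smul_mem hF c ha hb hab)
  exact ((F n).sub_mem_iff_left ((F n).smul_mem _ hab)).1 h

theorem expSubOne_mem (ha : a ∈ F 1) : expSubOne F a ∈ F 1 := seriesLim_mem hF _ ha

theorem expSubOne_sub_sub_mem (ha : a ∈ F 1) (hb : b ∈ F 1) {n : ℕ} (hab : a - b ∈ F n) :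
    expSubOne F a - expSubOne F b - (a - b) ∈ F (n + 1) := by
  have h := seriesLim_sub_sub_smul_mem hF (fun k => ((k + 1).factorial : K)⁻¹) ha hb hab
  simpa [← expSubOne_eq_seriesLim] using h

/-- When the exponentials agree, the first-order estimate pushes `a - b` one step deeper each time.
-/
theorem expSubOne_injOn : Set.InjOn (expSubOne F) (F 1) := by
  intro a ha b hb hab
  refine hF.eq_of_forall_sub_mem fun n => ?_
  induction n with
  | zero => rw [hF.zero_eq_top]; trivial
  | succ n ih => simpa [hab] using expSubOne_sub_sub_mem hF hb ha (by simpa using (F n).neg_mem ih)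

end Series

variable [IsScalarTower K A A] [SMulCommClass K A A]

omit [SMulCommClass K A A] in
theorem powSucc_neg (a : A) (k : ℕ) : powSucc (-a) k = (-1 : K) ^ (k + 1) • powSucc a k := by
  induction k with
  | zero => simp [powSucc]
  | succ k ih =>
    rw [powSucc, ih, powSucc, pow_succ _ (k + 1), mul_neg, smul_mul_assoc, mul_neg_one, neg_smul]

omit [SMulCommClass K A A] in
theorem logOneAdd_eq_seriesLim (F : ℕ → Submodule K A) (a : A) :
    logOneAdd F a = seriesLim F (fun k => (-1) ^ k * ((k + 1 : ℕ) : K)⁻¹) a := by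
  rw [logOneAdd, seriesLim]
  congr 1
  funext N
  rw [seriesSum, ← Finset.sum_neg_distrib]
  refine Finset.sum_congr rfl fun k _ => ?_
  rw [powSucc_neg (K := K), smul_smul, ← neg_smul, pow_succ]
  congr 1
  ring

theorem inr_powSucc (a : A) (k : ℕ) :
    (Unitization.inr (powSucc a k) : Unitization K A) = Unitization.inr a ^ (k + 1) := by
  induction k with
  | zero => simp [powSucc]
  | succ k ih => rw [powSucc, Unitization.inr_mul, ih, ← pow_succ]

theorem inr_seriesSum (c : ℕ → K) (a : A) (N : ℕ) :
    (Unitization.inr (seriesSum c a N) : Unitization K A) =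
      Polynomial.aeval (Unitization.inr a : Unitization K A)
        (∑ k ∈ Finset.range N, Polynomial.C (c k) * Polynomial.X ^ (k + 1)) := by
  induction N with
  | zero => simp [seriesSum]
  | succ N ih =>
    rw [seriesSum] at ih ⊢
    rw [Finset.sum_range_succ, Finset.sum_range_succ, Unitization.inr_add, ih, map_add,
      Unitization.inr_smul, inr_powSucc, map_mul, Polynomial.aeval_C, map_pow,
      Polynomial.aeval_X, Algebra.smul_def]

omit [IsScalarTower K A A] [SMulCommClass K A A] in
-- Polynomials are evaluated in the unitization. Each `F n` is a right ideal there because `F 0` is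
-- all of `A`, so a multiple of `a ^ (N + 1)` stays in the right step.
theorem exists_inr_mul_eq_inr {F : ℕ → Submodule K A} (hF : IsCompleteFilteredAlgebra F) {a : A}
    {n : ℕ} (ha : a ∈ F n) (w : Unitization K A) : ∃ b ∈ F n, Unitization.inr a * w =
      Unitization.inr b := by
  refine ⟨w.fst • a + a * w.snd, (F n).add_mem ((F n).smul_mem _ ha) ?_, ?_⟩
  · exact hF.mul_mem n 0 a ha _ (by rw [hF.zero_eq_top]; trivial)
  · ext <;> simp

variable [CharZero K] {F : ℕ → Submodule K A} (hF : IsCompleteFilteredAlgebra F) {a b : A}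
include hF

omit [SMulCommClass K A A] [CharZero K] in
theorem logOneAdd_mem (ha : a ∈ F 1) : logOneAdd F a ∈ F 1 := by
  rw [logOneAdd_eq_seriesLim]
  exact seriesLim_mem hF _ ha

omit [SMulCommClass K A A] [CharZero K] in
theorem logOneAdd_sub_sub_mem (ha : a ∈ F 1) (hb : b ∈ F 1) {n : ℕ} (hab : a - b ∈ F n) :
    logOneAdd F a - logOneAdd F b - (a - b) ∈ F (n + 1) := by
  rw [logOneAdd_eq_seriesLim, logOneAdd_eq_seriesLim]
  simpa using seriesLim_sub_sub_smul_mem hF (fun k => (-1) ^ k * ((k + 1 : ℕ) : K)⁻¹) ha hb hab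

/-- Modulo `F (N + 1)` both series may be truncated at `N`; what remains is the polynomial identity
at `a`, with error a multiple of `a ^ (N + 1)`. -/
theorem expSubOne_logOneAdd (ha : a ∈ F 1) : expSubOne F (logOneAdd F a) = a := by
  refine hF.eq_of_forall_sub_mem fun N => hF.antitone N.le_succ ?_
  rw [logOneAdd_eq_seriesLim, expSubOne_eq_seriesLim]
  set e : ℕ → K := fun k => ((k + 1).factorial : K)⁻¹
  set l : ℕ → K := fun k => (-1) ^ k * ((k + 1 : ℕ) : K)⁻¹
  have h1 := seriesLim_sub_mem_of_sub_mem hF e (seriesLim_mem hF l ha) (seriesSum_mem hF l ha N)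
    (seriesLim_sub_mem hF l ha N)
  have h2 := seriesLim_sub_mem hF e (seriesSum_mem hF l ha N) N
  have h3 : seriesSum e (seriesSum l a N) N - a ∈ F (N + 1) := by
    obtain ⟨q, hq⟩ := X_pow_dvd_expPoly_comp_logPoly_sub_X K N
    have h := congrArg (Polynomial.aeval (Unitization.inr a : Unitization K A)) hq
    rw [map_sub, Polynomial.aeval_comp, map_mul, Polynomial.aeval_X, map_pow, Polynomial.aeval_X,
      ← inr_powSucc] at h
    obtain ⟨b, hb, hab⟩ := exists_inr_mul_eq_inr hF (powSucc_mem hF ha N)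
      (Polynomial.aeval (Unitization.inr a : Unitization K A) q)
    rw [hab, logPoly, ← inr_seriesSum, expPoly, ← inr_seriesSum, ← Unitization.inr_sub] at h
    rw [Unitization.inr_injective h]
    exact hb
  simpa using (F (N + 1)).add_mem ((F (N + 1)).add_mem h1 h2) h3

/-- A right inverse of an injective map is also a left inverse. -/
theorem logOneAdd_expSubOne (ha : a ∈ F 1) : logOneAdd F (expSubOne F a) = a :=
  expSubOne_injOn hF (logOneAdd_mem hF (expSubOne_mem hF ha)) ha
    (expSubOne_logOneAdd hF (expSubOne_mem hF ha))

omit [IsScalarTower K A A] [SMulCommClass K A A] [CharZero K] in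
theorem expSubOne_mul_mem (ha : a ∈ F 1) (hb : b ∈ F 1) :
    expSubOne F a + expSubOne F b + expSubOne F a * expSubOne F b ∈ F 1 :=
  (F 1).add_mem ((F 1).add_mem (expSubOne_mem hF ha) (expSubOne_mem hF hb))
    (hF.antitone (Nat.le_succ 1)
      (hF.mul_mem 1 1 _ (expSubOne_mem hF ha) _ (expSubOne_mem hF hb)))

theorem expSubOne_hausdorff (ha : a ∈ F 1) (hb : b ∈ F 1) :
    expSubOne F (hausdorff F a b) =
      expSubOne F a + expSubOne F b + expSubOne F a * expSubOne F b :=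
  expSubOne_logOneAdd hF (expSubOne_mul_mem hF ha hb)

omit [SMulCommClass K A A] [CharZero K] in
-- To first order exp - 1 and log(1 + ·) are the identity, and the product term varies only in `F (n
-- + 1)` because its factors lie in `F 1`. So `C` varies like `x + y` modulo `F (n + 1)`.
theorem hausdorff_isContractingProduct : IsContractingProduct F (hausdorff F) where
  mem x hx y hy := logOneAdd_mem hF (expSubOne_mul_mem hF hx hy)
  bch_sub_mem n x hx x' hx' y hy y' hy' hxx hyy := by
    have h1 := expSubOne_sub_sub_mem hF hx hx' hxx
    have h2 := expSubOne_sub_sub_mem hF hy hy' hyy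
    have e1 : expSubOne F x - expSubOne F x' ∈ F n :=
      ((F n).sub_mem_iff_left hxx).1 (hF.antitone n.le_succ h1)
    have e2 : expSubOne F y - expSubOne F y' ∈ F n :=
      ((F n).sub_mem_iff_left hyy).1 (hF.antitone n.le_succ h2)
    have h3 := mul_sub_mul_mem hF (expSubOne_mem hF hx) (expSubOne_mem hF hy') e1 e2 rfl
    have e3 := (F n).add_mem ((F n).add_mem e1 e2) (hF.antitone n.le_succ h3)
    have h4 := logOneAdd_sub_sub_mem hF (expSubOne_mul_mem hF hx hy)
      (expSubOne_mul_mem hF hx' hy') (n := n) (by convert e3 using 1; abel)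
    have h5 := (F (n + 1)).add_mem h4 ((F (n + 1)).add_mem h3 ((F (n + 1)).add_mem h1 h2))
    convert h5 using 1
    simp only [bch, hausdorff]
    abel

theorem factorizationAndUniformization_hausdorff {B : Type w} [Ring B] [Algebra K B]
    (j : A →ₙₐ[K] B) (hj : Function.Injective j) {P : A →ₗ[K] A} (hPP : P ∘ₗ P = P)
    (hP : ∀ n, ∀ a ∈ F n, P a ∈ F n) :
    FactorizationAndUniformization F P (hausdorff F) (expIn F j) := by
  refine factorizationAndUniformization_of_isContractingProduct hPP hF.toIsCompleteFiltration
    (hausdorff_isContractingProduct hF) hP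
    (fun x hx y hy h => expSubOne_injOn hF hx hy (hj (add_left_cancel h))) fun x hx y hy => ?_
  rw [expIn, expSubOne_hausdorff hF hx hy, map_add, map_add, map_mul, expIn, expIn]
  noncomm_ring

end Associative

/-! ### Rearrangement of double sums -/

section DiagonalSums

open Finset

/-- The sum over a triangle and the sum over a square differ by terms with `n ≤ i + j`. -/
theorem sum_antidiagonal_sub_mem {M S : Type*} [AddCommGroup M] [SetLike S M]
    [AddSubgroupClass S M] (s : S) (h : ℕ → ℕ → M) (n : ℕ) (hs : ∀ i j, n ≤ i + j → h i j ∈ s) :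
    ∑ m ∈ range n, ∑ p ∈ antidiagonal m, h p.1 p.2 - ∑ i ∈ range n, ∑ j ∈ range n, h i j ∈ s := by
  simp only [Nat.sum_antidiagonal_eq_sum_range_succ h]
  rw [sum_range_diag_flip, ← sum_sub_distrib]
  refine sum_mem fun i _ => ?_
  rw [← neg_mem_iff, neg_sub, ← sum_Ico_eq_sub _ (Nat.sub_le n i)]
  refine sum_mem fun j hj => hs i j ?_
  rw [mem_Ico] at hj
  omega

/-- `(n + 1) ∑_{i + j = n + 1} a i * b j`, for a biadditive product, with the weight `n + 1 = i + j`
distributed to the factors. -/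
theorem sum_antidiagonal_leibniz {R M N P : Type*} [CommRing R] [AddCommGroup M] [Module R M]
    [AddCommGroup N] [Module R N] [AddCommGroup P] [Module R P] (m : M →ₗ[R] N →ₗ[R] P)
    (a : ℕ → M) (b : ℕ → N) (n : ℕ) :
    ((n + 1 : ℕ) : R) • ∑ p ∈ antidiagonal (n + 1), m (a p.1) (b p.2) =
      ∑ p ∈ antidiagonal n, (m (((p.1 + 1 : ℕ) : R) • a (p.1 + 1)) (b p.2) +
        m (a p.1) (((p.2 + 1 : ℕ) : R) • b (p.2 + 1))) := by
  rw [sum_add_distrib, smul_sum]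
  have h : ∀ p ∈ antidiagonal (n + 1), ((n + 1 : ℕ) : R) • m (a p.1) (b p.2) =
      m ((p.1 : R) • a p.1) (b p.2) + m (a p.1) ((p.2 : R) • b p.2) := fun p hp => by
    rw [← mem_antidiagonal.1 hp, Nat.cast_add, add_smul, map_smul, map_smul, LinearMap.smul_apply]
  rw [sum_congr rfl h, sum_add_distrib]
  congr 1
  · rw [Nat.sum_antidiagonal_succ]
    simp
  · rw [Nat.sum_antidiagonal_succ']
    simp

end DiagonalSums

/-- Functions on the words in the alphabet `α`. -/
def WordSeries (α : Type u) (A : Type v) : Type max u v := List α → A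

/-! ### Functions on words: shifts, unshuffle convolution, weights and lengths -/

namespace WordSeries

variable {K : Type u} {α : Type v} {A : Type w}

instance [AddCommGroup A] : AddCommGroup (WordSeries α A) :=
  inferInstanceAs (AddCommGroup (List α → A))

instance [Field K] [AddCommGroup A] [Module K A] : Module K (WordSeries α A) :=
  inferInstanceAs (Module K (List α → A))

section AddCommGroup

variable [AddCommGroup A]

theorem add_apply (f g : WordSeries α A) (w : List α) : (f + g) w = f w + g w := rfl

theorem sub_apply (f g : WordSeries α A) (w : List α) : (f - g) w = f w - g w := rfl

theorem smul_apply [Field K] [Module K A] (c : K) (f : WordSeries α A) (w : List α) :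
    (c • f) w = c • f w := rfl

theorem sum_apply {ι : Type*} (s : Finset ι) (f : ι → WordSeries α A) (w : List α) :
    (∑ i ∈ s, f i) w = ∑ i ∈ s, f i w :=
  map_sum (⟨⟨fun f => f w, rfl⟩, fun _ _ => rfl⟩ : WordSeries α A →+ A) _ _

/-- The series obtained by inserting the letter `a` at the head of the word. -/
def shift (a : α) : WordSeries α A →+ WordSeries α A where
  toFun f := fun w => f (a :: w)
  map_zero' := rfl
  map_add' _ _ := rfl

theorem shift_apply (a : α) (f : WordSeries α A) (w : List α) : shift a f w = f (a :: w) := rfl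

/-- The series supported on the empty word. -/
def const (c : A) : WordSeries α A
  | [] => c
  | _ :: _ => 0

theorem shift_const (a : α) (c : A) : shift a (const c : WordSeries α A) = 0 := rfl

theorem const_zero : (const 0 : WordSeries α A) = 0 := by
  funext w; cases w <;> rfl

theorem const_add (c d : A) : (const (c + d) : WordSeries α A) = const c + const d := by
  funext w; cases w
  · rfl
  · exact (add_zero 0).symm

theorem const_smul [Field K] [Module K A] (r : K) (c : A) :
    (const (r • c) : WordSeries α A) = r • const c := by
  funext w; cases w
  · rfl
  · exact (smul_zero r).symm

end AddCommGroup

section Convolution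

variable {B C : Type*} [AddCommGroup A] [AddCommGroup B] [AddCommGroup C]

/-- The convolution with respect to unshuffling of words, defined by the Leibniz rule
for `shift`. -/
def conv (m : A →+ B →+ C) : List α → WordSeries α A → WordSeries α B → C
  | [], f, g => m (f []) (g [])
  | a :: w, f, g => conv m w (shift a f) g + conv m w f (shift a g)

variable (m : A →+ B →+ C) (w : List α)

theorem conv_add_left (f f' : WordSeries α A) (g : WordSeries α B) :
    conv m w (f + f') g = conv m w f g + conv m w f' g := by
  induction w generalizing f f' g with
  | nil => simp [conv, add_apply]
  | cons a w ih => rw [conv, conv, conv, map_add, ih, ih]; abel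

theorem conv_add_right (f : WordSeries α A) (g g' : WordSeries α B) :
    conv m w f (g + g') = conv m w f g + conv m w f g' := by
  induction w generalizing f g g' with
  | nil => simp [conv, add_apply]
  | cons a w ih => rw [conv, conv, conv, map_add, ih, ih]; abel

theorem conv_zero_left (g : WordSeries α B) : conv m w (0 : WordSeries α A) g = 0 :=
  by
  have h := conv_add_left m w 0 0 g
  rwa [add_zero, left_eq_add] at h

theorem conv_zero_right (f : WordSeries α A) : conv m w f (0 : WordSeries α B) = 0 :=
  by
  have h := conv_add_right m w f 0 0
  rwa [add_zero, left_eq_add] at h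

theorem conv_const (a : A) (b : B) :
    conv m w (const a : WordSeries α A) (const b) = (const (m a b) : WordSeries α C) w := by
  cases w with
  | nil => rfl
  | cons c w => rw [conv, shift_const, shift_const, conv_zero_left, conv_zero_right]; simp [const]

theorem conv_smul_left [Field K] [Module K A] [Module K C]
    (hm : ∀ (c : K) a b, m (c • a) b = c • m a b) (c : K) (f : WordSeries α A)
    (g : WordSeries α B) : conv m w (c • f) g = c • conv m w f g := by
  induction w generalizing f g with
  | nil => exact hm _ _ _
  | cons a w ih => rw [conv, conv, smul_add, ← ih, ← ih]; rfl

theorem conv_smul_right [Field K] [Module K B] [Module K C]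
    (hm : ∀ (c : K) a b, m a (c • b) = c • m a b) (c : K) (f : WordSeries α A)
    (g : WordSeries α B) : conv m w f (c • g) = c • conv m w f g := by
  induction w generalizing f g with
  | nil => exact hm _ _ _
  | cons a w ih => rw [conv, conv, smul_add, ← ih, ← ih]; rfl

/-- Each term of the convolution distributes the letters of `w` between `f` and `g`; when `w` is too
short, one of the two receives too few. -/
theorem conv_eq_zero {i j : ℕ} {f : WordSeries α A} {g : WordSeries α B}
    (hf : ∀ v, v.length < i → f v = 0) (hg : ∀ v, v.length < j → g v = 0)
    (hw : w.length < i + j) : conv m w f g = 0 := by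
  induction w generalizing i j f g with
  | nil =>
    rw [conv]
    rcases Nat.eq_zero_or_pos i with rfl | hi
    · rw [hg [] (by simpa using hw), map_zero]
    · rw [hf [] hi, map_zero, AddMonoidHom.zero_apply]
  | cons a w ih =>
    rw [List.length_cons] at hw
    have h1 : ∀ v, v.length < i - 1 → shift a f v = 0 := fun v hv =>
      hf (a :: v) (by rw [List.length_cons]; omega)
    have h2 : ∀ v, v.length < j - 1 → shift a g v = 0 := fun v hv =>
      hg (a :: v) (by rw [List.length_cons]; omega)
    rw [conv, ih h1 hg (by omega), ih hf h2 (by omega), add_zero]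

/-- The letter-weight condition: a word with letters `p.2 ∈ F p.1` is mapped to the step of `G`
given by `k` plus the total weight. -/
def IsWeighted {L : Type*} [Field K] [AddCommGroup L] [Module K L] [Module K A]
    (F : ℕ → Submodule K L) (G : ℕ → Submodule K A) (k : ℕ) (f : WordSeries L A) : Prop :=
  ∀ l : List (ℕ × L), (∀ p ∈ l, p.2 ∈ F p.1) →
    f (l.map Prod.snd) ∈ G (k + (l.map Prod.fst).sum)

section IsWeighted

variable {L : Type*} [Field K] [AddCommGroup L] [Module K L] [Module K A] [Module K B]
  [Module K C] {F : ℕ → Submodule K L} {G : ℕ → Submodule K A} {G' : ℕ → Submodule K B}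
  {G'' : ℕ → Submodule K C} {i j : ℕ}

theorem IsWeighted.shift {f : WordSeries L A} (hf : IsWeighted F G i f) {x : L} (hx : x ∈ F j) :
    IsWeighted F G (i + j) (shift x f) := fun l hl => by
  have h := hf ((j, x) :: l) (List.forall_mem_cons.2 ⟨hx, hl⟩)
  rwa [List.map_cons, List.map_cons, List.sum_cons, ← add_assoc] at h

theorem IsWeighted.add {f g : WordSeries L A} (hf : IsWeighted F G i f)
    (hg : IsWeighted F G i g) : IsWeighted F G i (f + g) :=
  fun l hl => (G _).add_mem (hf l hl) (hg l hl)

theorem IsWeighted.sub {f g : WordSeries L A} (hf : IsWeighted F G i f)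
    (hg : IsWeighted F G i g) : IsWeighted F G i (f - g) :=
  fun l hl => (G _).sub_mem (hf l hl) (hg l hl)

theorem IsWeighted.smul {f : WordSeries L A} (c : K) (hf : IsWeighted F G i f) :
    IsWeighted F G i (c • f) :=
  fun l hl => (G _).smul_mem c (hf l hl)

theorem isWeighted_zero : IsWeighted F G i (0 : WordSeries L A) :=
  fun _ _ => (G _).zero_mem

theorem IsWeighted.sum {ι : Type*} {s : Finset ι} {f : ι → WordSeries L A}
    (hf : ∀ k ∈ s, IsWeighted F G i (f k)) : IsWeighted F G i (∑ k ∈ s, f k) := fun l hl => by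
  rw [sum_apply]
  exact (G _).sum_mem fun k hk => hf k hk l hl

theorem isWeighted_const {a : A} (ha : a ∈ G i) :
    IsWeighted F G i (const a : WordSeries L A) := by
  rintro (_ | ⟨p, l⟩) -
  · exact ha
  · exact (G _).zero_mem

theorem IsWeighted.conv (m : A →+ B →+ C)
    (hm : ∀ i j, ∀ a ∈ G i, ∀ b ∈ G' j, m a b ∈ G'' (i + j)) {f : WordSeries L A}
    {g : WordSeries L B} (hf : IsWeighted F G i f) (hg : IsWeighted F G' j g) :
    IsWeighted F G'' (i + j) (fun w => conv m w f g) := by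
  intro l hl
  induction l generalizing i j f g with
  | nil => exact hm _ _ _ (hf [] hl) _ (hg [] hl)
  | cons p l ih =>
    rw [List.forall_mem_cons] at hl
    rw [List.map_cons, List.map_cons, List.sum_cons]
    refine (G'' _).add_mem ?_ ?_
    · convert ih (hf.shift hl.1) hg hl.2 using 2; ring
    · convert ih hf (hg.shift hl.1) hl.2 using 2; ring

end IsWeighted

end Convolution

/-- The series vanishing on words of length less than `n`. -/
def lenFil (K : Type u) {α : Type v} {A : Type w} [Field K] [AddCommGroup A] [Module K A]
    (n : ℕ) : Submodule K (WordSeries α A) where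
  carrier := {f | ∀ v, v.length < n → f v = 0}
  zero_mem' _ _ := rfl
  add_mem' {f g} hf hg v hv := (congrArg₂ (· + ·) (hf v hv) (hg v hv)).trans (add_zero 0)
  smul_mem' c f hf v hv := by rw [smul_apply, hf v hv, smul_zero]

section lenFil

variable [Field K] [AddCommGroup A] [Module K A] {f g : WordSeries α A} {n : ℕ}

theorem lenFil_antitone : Antitone (lenFil K : ℕ → Submodule K (WordSeries α A)) :=
  fun _ _ h _ hf v hv => hf v (hv.trans_le h)

theorem mem_lenFil_zero (f : WordSeries α A) : f ∈ lenFil K 0 :=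
  fun _ hv => absurd hv (Nat.not_lt_zero _)

theorem eq_zero_of_forall_mem_lenFil (h : ∀ n, f ∈ lenFil K n) : f = 0 :=
  funext fun v => h (v.length + 1) v (Nat.lt_succ_self _)

theorem apply_eq_of_sub_mem_lenFil (h : f - g ∈ lenFil K n) {v : List α} (hv : v.length < n) :
    f v = g v :=
  sub_eq_zero.1 (h v hv)

theorem shift_mem_lenFil (a : α) (hf : f ∈ lenFil K (n + 1)) : shift a f ∈ lenFil K n :=
  fun _ hv => hf _ (Nat.succ_lt_succ hv)

theorem mem_lenFil_succ (h0 : f [] = 0) (h : ∀ a, shift a f ∈ lenFil K n) :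
    f ∈ lenFil K (n + 1) := by
  rintro (_ | ⟨a, v⟩) hv
  · exact h0
  · exact h a v (Nat.lt_of_succ_lt_succ hv)

end lenFil

/-! ### Word series with values in a Lie algebra -/

section Lie

variable {L : Type*} [LieRing L]

/-- The Lie bracket as a biadditive map. -/
def bracketHom (L : Type*) [LieRing L] : L →+ L →+ L :=
  AddMonoidHom.mk' (fun x => AddMonoidHom.mk' (fun y => ⁅x, y⁆) (lie_add x)) fun x y => by
    ext z; exact add_lie x y z

instance : Bracket (WordSeries α L) (WordSeries α L) := ⟨fun f g w => conv (bracketHom L) w f g⟩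

theorem shift_lie (a : α) (f g : WordSeries α L) :
    shift a ⁅f, g⁆ = ⁅shift a f, g⁆ + ⁅f, shift a g⁆ := rfl

/-- At the empty word the identities are those of `L`; since every shift is a derivation, they pass
to longer words by induction. -/
instance : LieRing (WordSeries α L) where
  add_lie f g h := funext fun w => conv_add_left _ w f g h
  lie_add f g h := funext fun w => conv_add_right _ w f g h
  lie_self f := by
    -- The shift of `⁅f, f⁆` is a sum of two mixed brackets, so antisymmetry is needed before
    -- `lie_self`.
    have skew : ∀ (w : List α) (f g : WordSeries α L), ⁅f, g⁆ w = -⁅g, f⁆ w := by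
      intro w
      induction w with
      | nil => intro f g; exact (lie_skew _ _).symm
      | cons a w ih =>
        intro f g
        change shift a ⁅f, g⁆ w = -shift a ⁅g, f⁆ w
        rw [shift_lie, shift_lie, add_apply, add_apply, ih, ih f, neg_add_rev]
    funext w
    induction w generalizing f with
    | nil => exact lie_self _
    | cons a w ih =>
      change shift a ⁅f, f⁆ w = 0
      rw [shift_lie, add_apply, skew w f, add_neg_cancel]
  leibniz_lie f g h := by
    have add_lie : ∀ f g h : WordSeries α L, ⁅f + g, h⁆ = ⁅f, h⁆ + ⁅g, h⁆ :=
      fun f g h => funext fun w => conv_add_left _ w f g h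
    have lie_add : ∀ f g h : WordSeries α L, ⁅f, g + h⁆ = ⁅f, g⁆ + ⁅f, h⁆ :=
      fun f g h => funext fun w => conv_add_right _ w f g h
    funext w
    induction w generalizing f g h with
    | nil => exact leibniz_lie _ _ _
    | cons a w ih =>
      change shift a ⁅f, ⁅g, h⁆⁆ w = shift a (⁅⁅f, g⁆, h⁆ + ⁅g, ⁅f, h⁆⁆) w
      simp only [shift_lie, map_add, lie_add, add_lie, add_apply]
      rw [ih, ih, ih]
      simp only [add_apply]
      abel

instance [Field K] [LieAlgebra K L] : LieAlgebra K (WordSeries α L) where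
  lie_smul c f g := funext fun w => conv_smul_right _ w (fun c a b => lie_smul c a b) c f g

theorem lie_const (x y : L) :
    ⁅(const x : WordSeries α L), (const y : WordSeries α L)⁆ = (const ⁅x, y⁆ : WordSeries α L) :=
  funext fun w => conv_const _ w x y

variable [Field K] [LieAlgebra K L]

theorem lie_mem_lenFil {f g : WordSeries α L} {i j : ℕ} (hf : f ∈ lenFil K i)
    (hg : g ∈ lenFil K j) : ⁅f, g⁆ ∈ lenFil K (i + j) :=
  fun w hw => conv_eq_zero _ w hf hg hw

theorem IsWeighted.lie {F : ℕ → Submodule K L}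
    (hF : ∀ m n : ℕ, ∀ a ∈ F m, ∀ b ∈ F n, ⁅a, b⁆ ∈ F (m + n)) {f g : WordSeries L L} {i j : ℕ}
    (hf : IsWeighted F F i f) (hg : IsWeighted F F j g) : IsWeighted F F (i + j) ⁅f, g⁆ :=
  IsWeighted.conv (bracketHom L) hF hf hg

variable (K L) in
/-- The shift as a derivation. -/
def shiftDer (a : α) : LieDerivation K (WordSeries α L) (WordSeries α L) where
  toLinearMap := { shift a with map_smul' := fun _ _ => rfl }
  leibniz' f g := by
    change ⁅shift a f, g⁆ + ⁅f, shift a g⁆ = ⁅f, shift a g⁆ - ⁅g, shift a f⁆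
    rw [← lie_skew, add_comm, sub_eq_add_neg]

theorem shiftDer_apply (a : α) (f : WordSeries α L) : shiftDer K L a f = shift a f := rfl

end Lie

end WordSeries

/-! ### The Maurer-Cartan equation, degree by degree -/

section MaurerCartan

variable {K : Type u} {N : Type v} [Field K] [LieRing N] [LieAlgebra K N]

/-- The terms `(-ad z)ᵏ / (k + 1)!` of the power series `(1 - exp (-ad z)) / ad z`. -/
noncomputable def adTerm (z : N) : ℕ → N →ₗ[K] N
  | 0 => LinearMap.id
  | k + 1 => -((k + 2 : ℕ) : K)⁻¹ • (LieAlgebra.ad K N z ∘ₗ adTerm z k)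

theorem adTerm_zero_apply (z f : N) : adTerm (K := K) z 0 f = f := rfl

theorem adTerm_succ_apply (z : N) (k : ℕ) (f : N) :
    adTerm (K := K) z (k + 1) f = -((k + 2 : ℕ) : K)⁻¹ • ⁅z, adTerm (K := K) z k f⁆ := rfl

theorem smul_adTerm_succ [CharZero K] (z : N) (k : ℕ) (f : N) :
    ((k + 2 : ℕ) : K) • adTerm (K := K) z (k + 1) f = -⁅z, adTerm (K := K) z k f⁆ := by
  rw [adTerm_succ_apply, smul_smul, mul_neg,
    mul_inv_cancel₀ (Nat.cast_ne_zero.2 (Nat.succ_ne_zero (k + 1))), neg_one_smul]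

open Finset in
/-- The Maurer-Cartan equation for the form `ω = ((1 - exp (-ad z)) / ad z) dz`, evaluated at two
derivations. -/
theorem adTerm_commutator_apply [CharZero K] (D E : LieDerivation K N N) (z : N) (n : ℕ) :
    adTerm (K := K) z (n + 1) (⁅D, E⁆ z) =
      D (adTerm (K := K) z (n + 1) (E z)) - E (adTerm (K := K) z (n + 1) (D z)) +
        ∑ p ∈ antidiagonal n, ⁅adTerm (K := K) z p.1 (D z), adTerm (K := K) z p.2 (E z)⁆ := by
  have leib : ∀ (D : LieDerivation K N N) (k : ℕ) (f : N),
      ((k + 2 : ℕ) : K) • D (adTerm (K := K) z (k + 1) f) =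
        -(⁅D z, adTerm (K := K) z k f⁆ + ⁅z, D (adTerm (K := K) z k f)⁆) := fun D k f => by
    rw [← map_smul, smul_adTerm_succ, map_neg, D.apply_lie_eq_add, add_comm]
  have cancel : ∀ {k : ℕ} {a b : N}, ((k + 2 : ℕ) : K) • a = ((k + 2 : ℕ) : K) • b → a = b :=
    fun {k} _ _ h => smul_right_injective N
      (r := ((k + 2 : ℕ) : K)) (Nat.cast_ne_zero.2 (Nat.succ_ne_zero (k + 1))) h
  have hDE : ⁅D, E⁆ z = D (E z) - E (D z) := LieDerivation.commutator_apply _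
  induction n with
  | zero =>
    apply cancel (k := 0)
    rw [smul_add, smul_sub, leib, leib, smul_adTerm_succ]
    simp only [adTerm_zero_apply, hDE, Nat.antidiagonal_zero, sum_singleton, lie_sub]
    rw [← lie_skew (E z) (D z)]
    push_cast
    rw [two_smul]
    abel
  | succ n ih =>
    apply cancel (k := n + 1)
    -- The factor `n + 3` splits as `(p.1 + 1) + (p.2 + 1)`. Each part lowers the index of one
    -- `adTerm` and creates a bracket with `z`; the Jacobi identity collects these into `ad z` of
    -- the previous sum, up to two boundary terms.
    have hsum : ((n + 1 + 2 : ℕ) : K) • ∑ p ∈ antidiagonal (n + 1),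
        ⁅adTerm (K := K) z p.1 (D z), adTerm (K := K) z p.2 (E z)⁆ =
        ⁅D z, adTerm (K := K) z (n + 1) (E z)⁆ + ⁅adTerm (K := K) z (n + 1) (D z), E z⁆ -
        ⁅z, ∑ p ∈ antidiagonal n, ⁅adTerm (K := K) z p.1 (D z), adTerm (K := K) z p.2 (E z)⁆⁆ := by
      have h : ∀ p ∈ antidiagonal (n + 1), ((n + 1 + 2 : ℕ) : K) •
          ⁅adTerm (K := K) z p.1 (D z), adTerm (K := K) z p.2 (E z)⁆ =
          ⁅((p.1 + 1 : ℕ) : K) • adTerm (K := K) z p.1 (D z), adTerm (K := K) z p.2 (E z)⁆ +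
          ⁅adTerm (K := K) z p.1 (D z), ((p.2 + 1 : ℕ) : K) • adTerm (K := K) z p.2 (E z)⁆ :=
        fun p hp => by
          rw [smul_lie, lie_smul, ← add_smul, ← Nat.cast_add, ← mem_antidiagonal.1 hp]
          congr 2
          ring
      rw [smul_sum, sum_congr rfl h, sum_add_distrib, Nat.sum_antidiagonal_succ,
        Nat.sum_antidiagonal_succ']
      simp only [smul_adTerm_succ, add_assoc, Nat.reduceAdd, adTerm_zero_apply, zero_add,
        Nat.cast_one, one_smul, lie_sum, leibniz_lie z, neg_lie, lie_neg, sum_neg_distrib,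
        sum_add_distrib]
      abel
    rw [smul_add, smul_sub, leib, leib, smul_adTerm_succ, ih, hsum, lie_add, lie_sub,
      ← lie_skew (E z)]
    abel

end MaurerCartan

/-! ### The universal logarithm `logWords` and its differential equation -/

namespace WordSeries

section Logarithm

variable {K : Type u} {α : Type w} {L : Type v} [Field K] [LieRing L] [LieAlgebra K L]

theorem adTerm_mem_lenFil {z f : WordSeries α L} (hz : z ∈ lenFil K 1) {n : ℕ}
    (hf : f ∈ lenFil K n) (k : ℕ) : adTerm (K := K) z k f ∈ lenFil K (k + n) := by
  induction k with
  | zero => simpa [adTerm_zero_apply] using hf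
  | succ k ih =>
    rw [adTerm_succ_apply, show k + 1 + n = 1 + (k + n) by ring]
    exact Submodule.smul_mem _ _ (lie_mem_lenFil hz ih)

theorem adTerm_mem_lenFil_self {z : WordSeries α L} (hz : z ∈ lenFil K 1) (f : WordSeries α L)
    (k : ℕ) : adTerm (K := K) z k f ∈ lenFil K k :=
  adTerm_mem_lenFil hz (mem_lenFil_zero f) k

theorem adTerm_sub_mem_lenFil {z z' f f' : WordSeries α L} (hz : z ∈ lenFil K 1)
    (hz' : z' ∈ lenFil K 1) {n : ℕ} (hzz : z - z' ∈ lenFil K (n + 1)) (hf : f - f' ∈ lenFil K n)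
    (k : ℕ) : adTerm (K := K) z k f - adTerm (K := K) z' k f' ∈ lenFil K (k + n) := by
  induction k with
  | zero => simpa [adTerm_zero_apply] using hf
  | succ k ih =>
    have h : ⁅z, adTerm (K := K) z k f⁆ - ⁅z', adTerm (K := K) z' k f'⁆ =
        ⁅z, adTerm (K := K) z k f - adTerm (K := K) z' k f'⁆ +
        ⁅z - z', adTerm (K := K) z' k f'⁆ := by
      rw [lie_sub, sub_lie]; abel
    rw [adTerm_succ_apply, adTerm_succ_apply, ← smul_sub, h]
    refine Submodule.smul_mem _ _ (Submodule.add_mem _ ?_ ?_)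
    · exact lenFil_antitone (by omega) (lie_mem_lenFil hz ih)
    · exact lenFil_antitone (by omega)
        (lie_mem_lenFil hzz (adTerm_mem_lenFil_self hz' f' k))

theorem adTerm_isWeighted {F : ℕ → Submodule K L}
    (hF : ∀ m n : ℕ, ∀ a ∈ F m, ∀ b ∈ F n, ⁅a, b⁆ ∈ F (m + n)) {z f : WordSeries L L}
    (hz : IsWeighted F F 0 z) {n : ℕ} (hf : IsWeighted F F n f) (k : ℕ) :
    IsWeighted F F n (adTerm (K := K) z k f) := by
  induction k with
  | zero => exact hf
  | succ k ih =>
    have h := hz.lie hF ih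
    rw [zero_add] at h
    exact h.smul _

/-- The relation `((1 - exp (-ad z)) / ad z) f = g`. -/
def HasTheta (K : Type u) [Field K] [LieAlgebra K L] (z f g : WordSeries α L) : Prop :=
  ∀ n, ∑ k ∈ Finset.range n, adTerm (K := K) z k f - g ∈ lenFil K n

section HasTheta

variable {z f f' g g' : WordSeries α L}

theorem HasTheta.sub (h : HasTheta K z f g) (h' : HasTheta K z f' g') :
    HasTheta K z (f - f') (g - g') := fun n => by
  have := (lenFil K n).sub_mem (h n) (h' n)
  simpa only [map_sub, Finset.sum_sub_distrib, sub_sub_sub_comm] using this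

theorem HasTheta.smul (c : K) (h : HasTheta K z f g) : HasTheta K z (c • f) (c • g) := fun n => by
  have := (lenFil K n).smul_mem c (h n)
  simpa only [map_smul, ← Finset.smul_sum, smul_sub] using this

theorem hasTheta_of_succ (hz : z ∈ lenFil K 1)
    (h : ∀ n, ∑ k ∈ Finset.range (n + 1), adTerm (K := K) z k f - g ∈ lenFil K n) :
    HasTheta K z f g := fun n => by
  have h1 := (lenFil K n).sub_mem (h n) (adTerm_mem_lenFil_self hz f n)
  rw [Finset.sum_range_succ] at h1
  convert h1 using 1
  abel

/-- The operator is the identity plus terms that raise the word-length order, hence injective. -/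
theorem HasTheta.eq_zero (hz : z ∈ lenFil K 1) (h : HasTheta K z f 0) : f = 0 := by
  refine eq_zero_of_forall_mem_lenFil (K := K) fun n => ?_
  induction n with
  | zero => exact mem_lenFil_zero f
  | succ n ih =>
    have h1 := h (n + 1)
    rw [Finset.sum_range_succ', sub_zero, adTerm_zero_apply] at h1
    refine (Submodule.add_mem_iff_right _ (Submodule.sum_mem _ fun k _ => ?_)).1 h1
    exact lenFil_antitone (by omega) (adTerm_mem_lenFil hz ih (k + 1))

open Finset in
/-- If `ω = ((1 - exp (-ad z)) / ad z) dz` takes constant values on two shifts, then it takes the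
bracket of these values on their commutator. -/
theorem HasTheta.commutator [CharZero K] (hz : z ∈ lenFil K 1) {a b : α} {x y : L}
    (ha : HasTheta K z (shift a z) (const x)) (hb : HasTheta K z (shift b z) (const y)) :
    HasTheta K z (⁅shiftDer K L a, shiftDer K L b⁆ z) (const ⁅x, y⁆) := by
  refine hasTheta_of_succ hz fun n => ?_
  have expand : ∑ k ∈ range (n + 1), adTerm (K := K) z k (⁅shiftDer K L a, shiftDer K L b⁆ z) =
      shift a (∑ k ∈ range (n + 1), adTerm (K := K) z k (shift b z)) -
      shift b (∑ k ∈ range (n + 1), adTerm (K := K) z k (shift a z)) +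
      ∑ m ∈ range n, ∑ p ∈ antidiagonal m,
        ⁅adTerm (K := K) z p.1 (shift a z), adTerm (K := K) z p.2 (shift b z)⁆ := by
    rw [sum_range_succ', sum_congr rfl fun k _ => adTerm_commutator_apply (K := K) _ _ z k,
      map_sum, map_sum, sum_range_succ', sum_range_succ' (fun k => shift b _), sum_add_distrib,
      sum_sub_distrib]
    simp only [shiftDer_apply, adTerm_zero_apply, LieDerivation.commutator_apply]
    abel
  -- Shifts annihilate constants, so both derivative terms of the Maurer-Cartan equation vanish
  -- modulo length `n` and only the bracket survives.
  have h1 : shift a (∑ k ∈ range (n + 1), adTerm (K := K) z k (shift b z)) ∈ lenFil K n := by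
    simpa [shift_const] using shift_mem_lenFil a (hb (n + 1))
  have h2 : shift b (∑ k ∈ range (n + 1), adTerm (K := K) z k (shift a z)) ∈ lenFil K n := by
    simpa [shift_const] using shift_mem_lenFil b (ha (n + 1))
  have h3 := sum_antidiagonal_sub_mem (lenFil K n) (fun i j =>
    ⁅adTerm (K := K) z i (shift a z), adTerm (K := K) z j (shift b z)⁆) n fun i j hij =>
      lenFil_antitone hij (lie_mem_lenFil (adTerm_mem_lenFil_self hz _ i)
        (adTerm_mem_lenFil_self hz _ j))
  have h4 : ∑ i ∈ range n, ∑ j ∈ range n,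
      ⁅adTerm (K := K) z i (shift a z), adTerm (K := K) z j (shift b z)⁆ - const ⁅x, y⁆ ∈
        lenFil K n := by
    have h := (lenFil K n).add_mem
      (lenFil_antitone (by omega) (lie_mem_lenFil (ha n)
        (mem_lenFil_zero (∑ j ∈ range n, adTerm (K := K) z j (shift b z)))))
      (lenFil_antitone (by omega) (lie_mem_lenFil (mem_lenFil_zero (const x)) (hb n)))
    have hsum : ∑ i ∈ range n, ∑ j ∈ range n,
        ⁅adTerm (K := K) z i (shift a z), adTerm (K := K) z j (shift b z)⁆ =
        ⁅∑ i ∈ range n, adTerm (K := K) z i (shift a z),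
          ∑ j ∈ range n, adTerm (K := K) z j (shift b z)⁆ := by
      rw [sum_lie]
      simp only [lie_sum]
    rw [← lie_const, hsum]
    convert h using 1
    rw [lie_sub, sub_lie]
    abel
  rw [expand]
  have h := (lenFil K n).add_mem ((lenFil K n).sub_mem h1 h2) ((lenFil K n).add_mem h3 h4)
  convert h using 1
  abel

end HasTheta

/-- One step of the recursion for `logWords`. -/
noncomputable def logStep (K : Type u) [Field K] [LieAlgebra K L] (z : WordSeries L L) :
    WordSeries L L
  | [] => 0
  -- This is the differential equation solved for its term of index zero. For `z` vanishing on the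
  -- empty word, terms of index above `w.length` vanish at `w`.
  | a :: w => const a w -
      ∑ k ∈ Finset.range w.length, adTerm (K := K) z (k + 1) (shift a z) w

/-- The iterates of `logStep`. -/
noncomputable def logApprox (K : Type u) (L : Type v) [Field K] [LieRing L] [LieAlgebra K L] :
    ℕ → WordSeries L L
  | 0 => 0
  | n + 1 => logStep K (logApprox K L n)

/-- The multilinear part of `log (exp x₁ ⋯ exp xₙ)`, as a function of the word `xₙ ⋯ x₁`. -/
noncomputable def logWords (K : Type u) (L : Type v) [Field K] [LieRing L] [LieAlgebra K L] :
    WordSeries L L :=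
  fun w => logApprox K L w.length w

theorem logStep_mem_lenFil (z : WordSeries L L) : logStep K z ∈ lenFil K 1 := by
  intro w hw
  rw [List.length_eq_zero_iff.1 (Nat.lt_one_iff.1 hw)]
  rfl

/-- Every term has at least one bracket with `z`, which takes a letter of `w`; so the value at `a ::
w` involves `z` only on shorter words. -/
theorem logStep_sub_mem_lenFil {z z' : WordSeries L L} (hz : z ∈ lenFil K 1)
    (hz' : z' ∈ lenFil K 1) {n : ℕ} (h : z - z' ∈ lenFil K n) :
    logStep K z - logStep K z' ∈ lenFil K (n + 1) := by
  refine mem_lenFil_succ (sub_self (0 : L)) fun a w hw => ?_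
  obtain ⟨n, rfl⟩ := Nat.exists_eq_add_of_lt (Nat.zero_lt_of_lt hw)
  rw [zero_add] at h hw
  have hs : shift a z - shift a z' ∈ lenFil K n := by
    rw [← map_sub]; exact shift_mem_lenFil a h
  change (const a w - _) - (const a w - _) = (0 : L)
  rw [sub_sub_sub_cancel_left, ← Finset.sum_sub_distrib]
  refine Finset.sum_eq_zero fun k _ => ?_
  have := adTerm_sub_mem_lenFil hz' hz (by simpa using (lenFil K (n + 1)).neg_mem h)
    (by simpa using (lenFil K n).neg_mem hs) (k + 1)
  exact this w (by omega)

theorem logApprox_mem_lenFil (n : ℕ) : logApprox K L n ∈ lenFil K 1 := by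
  cases n with
  | zero => exact Submodule.zero_mem _
  | succ n => exact logStep_mem_lenFil _

theorem logApprox_succ_sub_mem_lenFil (n : ℕ) :
    logApprox K L (n + 1) - logApprox K L n ∈ lenFil K (n + 1) := by
  induction n with
  | zero => exact Submodule.sub_mem _ (logApprox_mem_lenFil 1) (logApprox_mem_lenFil 0)
  | succ n ih =>
    exact logStep_sub_mem_lenFil (logApprox_mem_lenFil _) (logApprox_mem_lenFil _) ih

theorem logApprox_add_sub_mem_lenFil (n m : ℕ) :
    logApprox K L (n + m) - logApprox K L n ∈ lenFil K (n + 1) := by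
  induction m with
  | zero => simp
  | succ m ih =>
    have h := Submodule.add_mem _ (lenFil_antitone (by omega)
      (logApprox_succ_sub_mem_lenFil (K := K) (L := L) (n + m))) ih
    rwa [sub_add_sub_cancel] at h

theorem logWords_sub_logApprox_mem_lenFil (n : ℕ) :
    logWords K L - logApprox K L n ∈ lenFil K (n + 1) := by
  intro w hw
  obtain ⟨m, rfl⟩ := Nat.exists_eq_add_of_le (Nat.le_of_lt_succ hw)
  have h := logApprox_add_sub_mem_lenFil (K := K) (L := L) w.length m
  exact sub_eq_zero.2 (apply_eq_of_sub_mem_lenFil h (Nat.lt_succ_self _)).symm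

theorem logWords_mem_lenFil : logWords K L ∈ lenFil K 1 := by
  have h := logWords_sub_logApprox_mem_lenFil (K := K) (L := L) 0
  exact (Submodule.sub_mem_iff_left _ (logApprox_mem_lenFil 0)).1 h

theorem logStep_logWords : logStep K (logWords K L) = logWords K L := by
  refine sub_eq_zero.1 (eq_zero_of_forall_mem_lenFil (K := K) fun n => ?_)
  have h1 := logStep_sub_mem_lenFil logWords_mem_lenFil (logApprox_mem_lenFil n)
    (logWords_sub_logApprox_mem_lenFil (K := K) (L := L) n)
  have h2 := logWords_sub_logApprox_mem_lenFil (K := K) (L := L) (n + 1)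
  have h3 := lenFil_antitone (show n ≤ n + 1 + 1 by omega) (Submodule.sub_mem _ h1 h2)
  convert h3 using 1
  exact (sub_sub_sub_cancel_right _ _ _).symm

/-- This rearranges the fixed-point equation of `logStep`. It is the logarithmic form of ∂ₓ exp(z) =
exp(z) x. -/
theorem hasTheta_logWords (x : L) :
    HasTheta K (logWords K L) (shift x (logWords K L)) (const x) := by
  intro n w hw
  obtain ⟨m, rfl⟩ := Nat.exists_eq_add_of_lt hw
  have h1 : ∑ k ∈ Finset.range (w.length + m + 1),
      adTerm (K := K) (logWords K L) k (shift x (logWords K L)) w =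
      ∑ k ∈ Finset.range (w.length + 1),
        adTerm (K := K) (logWords K L) k (shift x (logWords K L)) w := by
    rw [add_right_comm, Finset.sum_range_add]
    exact add_eq_left.2 (Finset.sum_eq_zero fun k _ =>
      adTerm_mem_lenFil_self logWords_mem_lenFil _ _ w (by omega))
  have h2 : logWords K L (x :: w) = const x w - ∑ k ∈ Finset.range w.length,
      adTerm (K := K) (logWords K L) (k + 1) (shift x (logWords K L)) w := by
    conv_lhs => rw [← logStep_logWords]
    rfl
  rw [sub_apply, sum_apply, h1, Finset.sum_range_succ', adTerm_zero_apply, shift_apply, h2]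
  abel

/-- The recursion uses only linear combinations and brackets, and distributes the letters without
loss, so their weights add up. -/
theorem logApprox_isWeighted {F : ℕ → Submodule K L}
    (hF : ∀ m n : ℕ, ∀ a ∈ F m, ∀ b ∈ F n, ⁅a, b⁆ ∈ F (m + n)) (n : ℕ) :
    IsWeighted F F 0 (logApprox K L n) := by
  induction n with
  | zero => exact isWeighted_zero
  | succ n ih =>
    rintro (_ | ⟨p, l⟩) hl
    · exact Submodule.zero_mem _
    · rw [List.forall_mem_cons] at hl
      have hs := ih.shift hl.1
      rw [zero_add] at hs
      have h : IsWeighted F F p.1 (const p.2 - ∑ k ∈ Finset.range (l.map Prod.snd).length,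
          adTerm (K := K) (logApprox K L n) (k + 1) (shift p.2 (logApprox K L n))) :=
        (isWeighted_const hl.1).sub (IsWeighted.sum fun k _ => adTerm_isWeighted hF ih hs (k + 1))
      have h' := h l hl.2
      rw [sub_apply, sum_apply] at h'
      rw [List.map_cons, List.map_cons, List.sum_cons, zero_add]
      exact h'

theorem logWords_isWeighted {F : ℕ → Submodule K L}
    (hF : ∀ m n : ℕ, ∀ a ∈ F m, ∀ b ∈ F n, ⁅a, b⁆ ∈ F (m + n)) :
    IsWeighted F F 0 (logWords K L) :=
  fun l hl => logApprox_isWeighted hF _ l hl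

end Logarithm

end WordSeries

/-! ### Descent of `logWords` to the universal enveloping algebra -/

namespace WordSeries

section Relations

variable {K : Type u} {L : Type v} [Field K] [LieRing L] [LieAlgebra K L]

variable (K L) in
/-- The derivations of the algebra of word series which measure the failure of `shift` to be a
representation of the Lie algebra `L`. -/
inductive RelDer : LieDerivation K (WordSeries L L) (WordSeries L L) → Prop
  | add (x y : L) : RelDer (shiftDer K L (x + y) - shiftDer K L x - shiftDer K L y)
  | smul (c : K) (x : L) : RelDer (shiftDer K L (c • x) - c • shiftDer K L x)
  | lie (x y : L) : RelDer (shiftDer K L ⁅x, y⁆ - ⁅shiftDer K L x, shiftDer K L y⁆)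

variable {D : LieDerivation K (WordSeries L L) (WordSeries L L)}

theorem RelDer.apply_const (hD : RelDer K L D) (x : L) : D (const x) = 0 := by
  cases hD <;>
  simp [LieDerivation.sub_apply, LieDerivation.smul_apply,
    shiftDer_apply, shift_const]

theorem RelDer.apply_mem_lenFil (hD : RelDer K L D) {f : WordSeries L L} {n : ℕ}
    (hf : f ∈ lenFil K (n + 2)) : D f ∈ lenFil K n := by
  have h1 : ∀ x, shift x f ∈ lenFil K (n + 1) := fun x => shift_mem_lenFil x hf
  have h2 : ∀ x, shift x f ∈ lenFil K n := fun x => lenFil_antitone n.le_succ (h1 x)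
  cases hD with
  | add x y => exact Submodule.sub_mem _ (Submodule.sub_mem _ (h2 _) (h2 _)) (h2 _)
  | smul c x => exact Submodule.sub_mem _ (h2 _) (Submodule.smul_mem _ _ (h2 _))
  | lie x y =>
    rw [LieDerivation.sub_apply, LieDerivation.commutator_apply]
    exact Submodule.sub_mem _ (h2 _) (Submodule.sub_mem _ (shift_mem_lenFil _ (h1 _))
      (shift_mem_lenFil _ (h1 _)))

/-- By linearity, or by the Maurer-Cartan equation for brackets, `D` applied to `logWords` solves
the differential equation with right-hand side zero, and the operator is injective. -/
theorem RelDer.apply_logWords [CharZero K] (hD : RelDer K L D) : D (logWords K L) = 0 := by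
  have hz := logWords_mem_lenFil (K := K) (L := L)
  have h := hasTheta_logWords (K := K) (L := L)
  cases hD with
  | add x y =>
    refine HasTheta.eq_zero hz ?_
    have := ((h (x + y)).sub (h x)).sub (h y)
    rwa [const_add, add_sub_cancel_left, sub_self] at this
  | smul c x =>
    refine HasTheta.eq_zero hz ?_
    have := (h (c • x)).sub ((h x).smul c)
    rwa [const_smul, sub_self] at this
  | lie x y =>
    refine HasTheta.eq_zero hz ?_
    have := (h ⁅x, y⁆).sub (HasTheta.commutator hz (h x) (h y))
    rwa [sub_self] at this

variable (K L) in
/-- The series whose first `n` iterated shifts are annihilated by the derivations `RelDer`. -/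
def compat : ℕ → Submodule K (WordSeries L L)
  | 0 => ⨅ D, ⨅ _ : RelDer K L D, LinearMap.ker D.toLinearMap
  | n + 1 => (⨅ D, ⨅ _ : RelDer K L D, LinearMap.ker D.toLinearMap) ⊓
      ⨅ x, (compat n).comap (shiftDer K L x).toLinearMap

variable {f g : WordSeries L L} {n : ℕ}

theorem mem_compat_zero : f ∈ compat K L 0 ↔ ∀ D, RelDer K L D → D f = 0 := by
  simp only [compat, Submodule.mem_iInf]
  rfl

theorem mem_compat_succ :
    f ∈ compat K L (n + 1) ↔ f ∈ compat K L 0 ∧ ∀ x, shift x f ∈ compat K L n := by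
  have h : compat K L (n + 1) =
      compat K L 0 ⊓ ⨅ x, (compat K L n).comap (shiftDer K L x).toLinearMap := rfl
  rw [h, Submodule.mem_inf, Submodule.mem_iInf]
  rfl

theorem compat_succ_le (n : ℕ) : compat K L (n + 1) ≤ compat K L n := by
  induction n with
  | zero => exact fun f hf => (mem_compat_succ.1 hf).1
  | succ n ih =>
    exact fun f hf => mem_compat_succ.2
      ⟨(mem_compat_succ.1 hf).1, fun x => ih ((mem_compat_succ.1 hf).2 x)⟩

theorem const_mem_compat (x : L) (n : ℕ) : const x ∈ compat K L n := by
  have h0 : const x ∈ compat K L 0 := mem_compat_zero.2 fun D hD => hD.apply_const x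
  cases n with
  | zero => exact h0
  | succ n => exact mem_compat_succ.2 ⟨h0, fun y => Submodule.zero_mem _⟩

theorem lie_mem_compat (hf : f ∈ compat K L n) (hg : g ∈ compat K L n) :
    ⁅f, g⁆ ∈ compat K L n := by
  have h0 : ∀ {f g}, f ∈ compat K L 0 → g ∈ compat K L 0 → ⁅f, g⁆ ∈ compat K L 0 := by
    intro f g hf hg
    rw [mem_compat_zero] at hf hg ⊢
    intro D hD
    rw [D.apply_lie_eq_sub, hf D hD, hg D hD, lie_zero, lie_zero, sub_zero]
  induction n generalizing f g with
  | zero => exact h0 hf hg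
  | succ n ih =>
    have hf' := compat_succ_le n hf
    have hg' := compat_succ_le n hg
    rw [mem_compat_succ] at hf hg ⊢
    exact ⟨h0 hf.1 hg.1, fun x => Submodule.add_mem _ (ih (hf.2 x) hg') (ih hf' (hg.2 x))⟩

/-- `compat` is closed in the length topology: the relation derivations lower the length by at most
two and are therefore continuous. -/
theorem mem_compat_of_forall_exists (h : ∀ m, ∃ g ∈ compat K L n, f - g ∈ lenFil K m) :
    f ∈ compat K L n := by
  have h0 : ∀ {f}, (∀ m, ∃ g ∈ compat K L 0, f - g ∈ lenFil K m) → f ∈ compat K L 0 := by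
    intro f h
    refine mem_compat_zero.2 fun D hD => eq_zero_of_forall_mem_lenFil (K := K) fun m => ?_
    obtain ⟨g, hg, hfg⟩ := h (m + 2)
    have := hD.apply_mem_lenFil hfg
    rwa [map_sub, mem_compat_zero.1 hg D hD, sub_zero] at this
  induction n generalizing f with
  | zero => exact h0 h
  | succ n ih =>
    refine mem_compat_succ.2 ⟨h0 fun m => ?_, fun x => ih fun m => ?_⟩
    · obtain ⟨g, hg, hfg⟩ := h m
      exact ⟨g, (mem_compat_succ.1 hg).1, hfg⟩
    · obtain ⟨g, hg, hfg⟩ := h (m + 1)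
      exact ⟨shift x g, (mem_compat_succ.1 hg).2 x, by
        rw [← map_sub]; exact shift_mem_lenFil x hfg⟩

/-- The operator is inverted by iteration; the approximations arise from `g` and `z` by brackets and
linear combinations, which stay in `compat`, and `compat` is closed. -/
theorem HasTheta.mem_compat {z : WordSeries L L} (hz : z ∈ lenFil K 1) (hzc : z ∈ compat K L n)
    (hg : g ∈ compat K L n) (h : HasTheta K z f g) : f ∈ compat K L n := by
  have hterm : ∀ {f}, f ∈ compat K L n → ∀ k, adTerm (K := K) z k f ∈ compat K L n := by
    intro f hf k
    induction k with
    | zero => exact hf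
    | succ k ih => exact Submodule.smul_mem _ _ (lie_mem_compat hzc ih)
  refine mem_compat_of_forall_exists fun m => ?_
  induction m with
  | zero => exact ⟨0, Submodule.zero_mem _, mem_lenFil_zero _⟩
  | succ m ih =>
    obtain ⟨f', hf', hff⟩ := ih
    refine ⟨g - ∑ k ∈ Finset.range m, adTerm (K := K) z (k + 1) f',
      Submodule.sub_mem _ hg (Submodule.sum_mem _ fun k _ => hterm hf' (k + 1)), ?_⟩
    have h1 := h (m + 1)
    have h2 : ∑ k ∈ Finset.range m, adTerm (K := K) z (k + 1) (f - f') ∈ lenFil K (m + 1) :=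
      Submodule.sum_mem _ fun k _ =>
        lenFil_antitone (by omega) (adTerm_mem_lenFil hz hff (k + 1))
    have h3 := Submodule.sub_mem _ h1 h2
    rw [Finset.sum_range_succ', adTerm_zero_apply] at h3
    simp only [map_sub, Finset.sum_sub_distrib] at h3
    convert h3 using 1
    abel

/-- A module over `L` must be stable under all iterated shifts. The differential equation recovers
each shift of `logWords` from `logWords` and a constant, which gains one level of `compat`. -/
theorem logWords_mem_compat [CharZero K] (n : ℕ) : logWords K L ∈ compat K L n := by
  have h0 : logWords K L ∈ compat K L 0 := mem_compat_zero.2 fun D hD => hD.apply_logWords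
  induction n with
  | zero => exact h0
  | succ n ih =>
    exact mem_compat_succ.2 ⟨h0, fun x => HasTheta.mem_compat logWords_mem_lenFil ih
      (const_mem_compat x n) (hasTheta_logWords x)⟩

variable (K L) in
/-- The series on which `shift` is a representation of `L`. -/
def compatSubmodule : Submodule K (WordSeries L L) := ⨅ n, compat K L n

theorem mem_compatSubmodule : f ∈ compatSubmodule K L ↔ ∀ n, f ∈ compat K L n :=
  Submodule.mem_iInf _

theorem shift_mem_compatSubmodule (x : L) (hf : f ∈ compatSubmodule K L) :
    shift x f ∈ compatSubmodule K L :=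
  mem_compatSubmodule.2 fun n => (mem_compat_succ.1 (mem_compatSubmodule.1 hf (n + 1))).2 x

theorem RelDer.apply_eq_zero (hD : RelDer K L D) (hf : f ∈ compatSubmodule K L) : D f = 0 :=
  mem_compat_zero.1 (mem_compatSubmodule.1 hf 0) D hD

attribute [local instance 100] LieRing.ofAssociativeRing

variable (K L) in
/-- The representation of `L` by shifts. -/
def shiftRep : L →ₗ⁅K⁆ Module.End K (compatSubmodule K L) where
  toFun x := (shiftDer K L x).toLinearMap.restrict fun _ hf => shift_mem_compatSubmodule x hf
  map_add' x y := by
    ext1 f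
    have h := (RelDer.add (K := K) x y).apply_eq_zero f.2
    rw [LieDerivation.sub_apply, LieDerivation.sub_apply, sub_sub, sub_eq_zero] at h
    exact Subtype.ext h
  map_smul' c x := by
    ext1 f
    have h := (RelDer.smul c x).apply_eq_zero f.2
    rw [LieDerivation.sub_apply, sub_eq_zero] at h
    exact Subtype.ext h
  map_lie' {x y} := by
    ext1 f
    have h := (RelDer.lie (K := K) x y).apply_eq_zero f.2
    rw [LieDerivation.sub_apply, sub_eq_zero, LieDerivation.commutator_apply] at h
    exact Subtype.ext h

theorem shiftRep_apply (x : L) (f : compatSubmodule K L) :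
    (shiftRep K L x f : WordSeries L L) = shift x f := rfl

theorem lift_shiftRep_prod_apply (l : List L) (f : compatSubmodule K L) (w : List L) :
    (UniversalEnvelopingAlgebra.lift K (shiftRep K L)
      (l.map (UniversalEnvelopingAlgebra.ι K)).prod f : WordSeries L L) w =
      (f : WordSeries L L) (l.reverse ++ w) := by
  induction l generalizing w with
  | nil => simp
  | cons x l ih =>
    rw [List.map_cons, List.prod_cons, map_mul, UniversalEnvelopingAlgebra.lift_ι_apply,
      Module.End.mul_apply, shiftRep_apply, shift_apply, ih]
    simp

variable (K L) in
/-- The canonical projection of the universal enveloping algebra onto `L`. -/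
noncomputable def envelopingProj [CharZero K] : UniversalEnvelopingAlgebra K L →ₗ[K] L where
  toFun u := (UniversalEnvelopingAlgebra.lift K (shiftRep K L) u
    ⟨logWords K L, mem_compatSubmodule.2 logWords_mem_compat⟩ : WordSeries L L) []
  map_add' u v := by rw [map_add]; rfl
  map_smul' c u := by rw [map_smul]; rfl

theorem envelopingProj_prod [CharZero K] (l : List L) :
    envelopingProj K L (l.map (UniversalEnvelopingAlgebra.ι K)).prod =
      logWords K L l.reverse := by
  have h := lift_shiftRep_prod_apply (K := K) l
    ⟨logWords K L, mem_compatSubmodule.2 logWords_mem_compat⟩ []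
  rwa [List.append_nil] at h

theorem logWords_singleton (x : L) : logWords K L [x] = x := by
  have h := apply_eq_of_sub_mem_lenFil (hasTheta_logWords (K := K) x 1) (v := []) zero_lt_one
  rw [Finset.sum_range_one] at h
  exact h

theorem envelopingProj_ι [CharZero K] (x : L) :
    envelopingProj K L (UniversalEnvelopingAlgebra.ι K x) = x := by
  have h := envelopingProj_prod (K := K) [x]
  rwa [List.map_singleton, List.prod_singleton, List.reverse_singleton, logWords_singleton] at h

end Relations

end WordSeries

/-! ### The filtration of the enveloping algebra -/

section EnvelopingFiltration

variable {K : Type u} {L : Type v} [Field K] [LieRing L] [LieAlgebra K L]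
  {F : ℕ → Submodule K L}

open UniversalEnvelopingAlgebra

theorem mul_mem_weightedProducts {m n : ℕ} {a b : UniversalEnvelopingAlgebra K L}
    (ha : a ∈ weightedProducts F m) (hb : b ∈ weightedProducts F n) :
    a * b ∈ weightedProducts F (m + n) := by
  obtain ⟨l, h1, h2, rfl⟩ := ha
  obtain ⟨l', h1', h2', rfl⟩ := hb
  refine ⟨l ++ l', ?_, ?_, ?_⟩
  · intro p hp
    exact (List.mem_append.1 hp).elim (h1 p) (h1' p)
  · rw [List.map_append, List.sum_append]; omega
  · rw [List.map_append, List.prod_append]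

theorem span_weightedProducts_mul_mem {m n : ℕ} {a b : UniversalEnvelopingAlgebra K L}
    (ha : a ∈ Submodule.span K (weightedProducts F m))
    (hb : b ∈ Submodule.span K (weightedProducts F n)) :
    a * b ∈ Submodule.span K (weightedProducts F (m + n)) := by
  have h := Submodule.mul_mem_mul ha hb
  rw [Submodule.span_mul_span] at h
  exact Submodule.span_mono (Set.mul_subset_iff.2 fun a ha b hb =>
    mul_mem_weightedProducts ha hb) h

attribute [local instance 100] LieRing.ofAssociativeRing

/-- The universal property gives a section of the inclusion of `S`. -/
theorem subalgebra_eq_top_of_ι_mem (S : Subalgebra K (UniversalEnvelopingAlgebra K L))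
    (hS : ∀ x : L, ι K x ∈ S) : S = ⊤ := by
  let g : L →ₗ⁅K⁆ S :=
    { toFun := fun x => ⟨ι K x, hS x⟩
      map_add' := fun x y => Subtype.ext (map_add (ι K) x y)
      map_smul' := fun c x => Subtype.ext (map_smul (ι K) c x)
      map_lie' := fun {x y} => Subtype.ext (LieHom.map_lie (ι K) x y) }
  have hg : S.val.comp (lift K g) = AlgHom.id K _ := by
    refine hom_ext (R := K) (L := L) (LieHom.ext fun x => ?_)
    change ((lift K g (ι K x) : S) : UniversalEnvelopingAlgebra K L) = ι K x
    rw [lift_ι_apply]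
    rfl
  refine eq_top_iff.2 fun u _ => ?_
  have h : ((lift K g u : S) : UniversalEnvelopingAlgebra K L) = u := DFunLike.congr_fun hg u
  exact h ▸ (lift K g u).2

theorem span_weightedProducts_zero (h0 : F 0 = ⊤) :
    Submodule.span K (weightedProducts F 0) = ⊤ := by
  have one_mem : (1 : UniversalEnvelopingAlgebra K L) ∈ weightedProducts F 0 :=
    ⟨[], by simp, le_rfl, by rw [List.map_nil, List.prod_nil]⟩
  have hι : ∀ x : L, ι K x ∈ weightedProducts F 0 := fun x =>
    ⟨[(0, x)], by simp [h0], Nat.zero_le _,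
      by rw [List.map_singleton, List.prod_singleton]⟩
  have hmul : ∀ a b, a ∈ Submodule.span K (weightedProducts F 0) →
      b ∈ Submodule.span K (weightedProducts F 0) →
      a * b ∈ Submodule.span K (weightedProducts F 0) := fun a b ha hb => by
    have h := span_weightedProducts_mul_mem ha hb
    rwa [Nat.add_zero] at h
  have h := subalgebra_eq_top_of_ι_mem
    ((Submodule.span K (weightedProducts F 0)).toSubalgebra (Submodule.subset_span one_mem) hmul)
    fun x => Submodule.subset_span (hι x)
  refine eq_top_iff.2 fun u _ => ?_
  rw [← Submodule.mem_toSubalgebra (h_one := Submodule.subset_span one_mem) (h_mul := hmul), h]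
  exact Algebra.mem_top

/-- The ideal generated by the weighted products is their linear span. -/
theorem mem_envelopingFiltration_iff (h0 : F 0 = ⊤) {n : ℕ} {u : UniversalEnvelopingAlgebra K L} :
    u ∈ envelopingFiltration F n ↔ u ∈ Submodule.span K (weightedProducts F n) := by
  have htop : ∀ u, u ∈ Submodule.span K (weightedProducts F 0) := fun u => by
    rw [span_weightedProducts_zero h0]; trivial
  constructor
  -- The span is already a two-sided ideal, since products of weight at least zero span the whole
  -- algebra and weights add.
  · let I : TwoSidedIdeal (UniversalEnvelopingAlgebra K L) :=
      TwoSidedIdeal.mk' (Submodule.span K (weightedProducts F n)) (Submodule.zero_mem _)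
        (Submodule.add_mem _) (Submodule.neg_mem _)
        (fun {x y} hy => by
          have h := span_weightedProducts_mul_mem (htop x) hy
          rwa [zero_add] at h)
        (fun {x y} hx => by
          have h := span_weightedProducts_mul_mem hx (htop y)
          rwa [add_zero] at h)
    have hI : TwoSidedIdeal.span (weightedProducts F n) ≤ I :=
      TwoSidedIdeal.span_le.2 fun a ha => by
        rw [TwoSidedIdeal.coe_mk']
        exact Submodule.subset_span ha
    intro hu
    have h := hI (TwoSidedIdeal.mem_asIdeal.1 hu)
    rwa [TwoSidedIdeal.mem_mk'] at h
  · have h : Submodule.span K (weightedProducts F n) ≤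
        (envelopingFiltration F n).restrictScalars K :=
      Submodule.span_le.2 fun a ha => TwoSidedIdeal.mem_asIdeal.2 (TwoSidedIdeal.subset_span ha)
    exact fun hu => h hu

/-- The filtration of a Lie algebra is induced by the one of its universal enveloping algebra. -/
theorem mem_of_ι_mem_envelopingFiltration [CharZero K] (hF : IsCompleteFilteredLieAlgebra F)
    {n : ℕ} {x : L} (hx : ι K x ∈ envelopingFiltration F n) : x ∈ F n := by
  rw [mem_envelopingFiltration_iff hF.zero_eq_top] at hx
  -- On a product of letters the projection is a value of `logWords`, which lies in the step given
  -- by the total weight; and it fixes `x`.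
  have h : Submodule.span K (weightedProducts F n) ≤
      (F n).comap (WordSeries.envelopingProj K L) := by
    rw [Submodule.span_le]
    rintro _ ⟨l, h1, h2, rfl⟩
    have h3 := WordSeries.logWords_isWeighted hF.lie_mem l.reverse
      (fun p hp => h1 p (List.mem_reverse.1 hp))
    have h4 := WordSeries.envelopingProj_prod (K := K) (l.map Prod.snd)
    rw [List.map_map] at h4
    change WordSeries.envelopingProj K L (l.map (ι K ∘ Prod.snd)).prod ∈ F n
    rw [h4, ← List.map_reverse]
    refine hF.antitone ?_ h3
    rwa [List.map_reverse, List.sum_reverse, zero_add]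
  have h5 := h hx
  rwa [Submodule.mem_comap, WordSeries.envelopingProj_ι] at h5

end EnvelopingFiltration

/-! ### The derivative of the exponential series -/

section DividedPowers

open Finset

variable {K : Type u} {A : Type v} [Field K] [CharZero K] [Ring A] [Algebra K A]

variable (K) in
/-- The truncated exponential series. -/
noncomputable def expSum (a : A) (n : ℕ) : A := ∑ k ∈ range n, ((k.factorial : K)⁻¹) • a ^ k

theorem succ_smul_factorial_inv_smul {M : Type*} [AddCommGroup M] [Module K M] (n : ℕ) (m : M) :
    ((n + 1 : ℕ) : K) • (((n + 1).factorial : K)⁻¹ • m) = ((n.factorial : K)⁻¹) • m := by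
  rw [smul_smul, Nat.factorial_succ, Nat.cast_mul, mul_inv, ← mul_assoc,
    mul_inv_cancel₀ (Nat.cast_ne_zero.2 n.succ_ne_zero), one_mul]

/-- The derivative of the exponential series, in each degree: if `Y k = (-ad z)ᵏ (D z) / (k + 1)!`
then `D (exp z) = exp z * ∑ Y k`. -/
theorem derivation_pow_div_factorial (D : A →+ A) (hD : ∀ a b, D (a * b) = D a * b + a * D b)
    (hDK : ∀ (c : K) a, D (c • a) = c • D a) {z : A} {Y : ℕ → A} (h0 : Y 0 = D z)
    (hY : ∀ k, ((k + 2 : ℕ) : K) • Y (k + 1) = Y k * z - z * Y k) (n : ℕ) :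
    D ((((n + 1).factorial : K)⁻¹) • z ^ (n + 1)) =
      ∑ p ∈ antidiagonal n, ((p.1.factorial : K)⁻¹ • z ^ p.1) * Y p.2 := by
  induction n with
  | zero => simp [h0]
  | succ n ih =>
    refine smul_right_injective A (r := ((n + 1 + 1 : ℕ) : K))
      (Nat.cast_ne_zero.2 (n + 1).succ_ne_zero) ?_
    have he : ∀ i : ℕ, ((i + 1 : ℕ) : K) • (((i + 1).factorial : K)⁻¹ • z ^ (i + 1)) =
        ((i.factorial : K)⁻¹ • z ^ i) * z := fun i => by
      rw [succ_smul_factorial_inv_smul, pow_succ, smul_mul_assoc]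
    have hsplit : ∀ p ∈ antidiagonal (n + 1), ((n + 1 + 1 : ℕ) : K) •
        (((p.1.factorial : K)⁻¹ • z ^ p.1) * Y p.2) =
        ((p.1 : K) • ((p.1.factorial : K)⁻¹ • z ^ p.1)) * Y p.2 +
        ((p.1.factorial : K)⁻¹ • z ^ p.1) * (((p.2 + 1 : ℕ) : K) • Y p.2) := fun p hp => by
      rw [smul_mul_assoc (p.1 : K), mul_smul_comm, ← add_smul, ← mem_antidiagonal.1 hp]
      push_cast
      congr 1
      ring
    change ((n + 1 + 1 : ℕ) : K) • D _ = ((n + 1 + 1 : ℕ) : K) • _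
    rw [← hDK, he, hD, ih, smul_sum, sum_congr rfl hsplit, sum_add_distrib,
      Nat.sum_antidiagonal_succ, Nat.sum_antidiagonal_succ', sum_mul]
    -- Moving `z` to the left past `Y p.2` produces, by `hY`, a multiple of `Y (p.2 + 1)`.
    have hterm : ∀ p ∈ antidiagonal n, ((p.1.factorial : K)⁻¹ • z ^ p.1) * Y p.2 * z =
        (((p.1 + 1 : ℕ) : K) • (((p.1 + 1).factorial : K)⁻¹ • z ^ (p.1 + 1))) * Y p.2 +
        ((p.1.factorial : K)⁻¹ • z ^ p.1) * (((p.2 + 1 + 1 : ℕ) : K) • Y (p.2 + 1)) :=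
      fun p _ => by
        rw [he, hY, mul_sub]
        noncomm_ring
    rw [sum_congr rfl hterm, sum_add_distrib, h0]
    simp
    abel

end DividedPowers

/-! ### Word series with values in a ring, and divided shifts -/

namespace WordSeries

section Ring

variable {K : Type u} {α : Type v} {R : Type w} [Ring R]

instance : Mul (WordSeries α R) := ⟨fun f g w => conv AddMonoidHom.mul w f g⟩

instance : One (WordSeries α R) := ⟨const 1⟩

theorem one_def : (1 : WordSeries α R) = const 1 := rfl

theorem shift_mul (a : α) (f g : WordSeries α R) :
    shift a (f * g) = shift a f * g + f * shift a g := rfl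

instance : Ring (WordSeries α R) :=
  { (inferInstance : AddCommGroup (WordSeries α R)),
    (inferInstance : Mul (WordSeries α R)), (inferInstance : One (WordSeries α R)) with
    left_distrib := fun f g h => funext fun w => conv_add_right _ w f g h
    right_distrib := fun f g h => funext fun w => conv_add_left _ w f g h
    zero_mul := fun f => funext fun w => conv_zero_left _ w f
    mul_zero := fun f => funext fun w => conv_zero_right _ w f
    one_mul := fun f => by
      funext w
      induction w generalizing f with
      | nil => exact one_mul _
      | cons a w ih =>
        have h : (0 : WordSeries α R) * f = 0 := funext fun w => conv_zero_left _ w f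
        change (shift a (1 * f)) w = shift a f w
        rw [shift_mul, one_def, shift_const, h, zero_add]
        exact ih _
    mul_one := fun f => by
      funext w
      induction w generalizing f with
      | nil => exact mul_one _
      | cons a w ih =>
        have h : f * (0 : WordSeries α R) = 0 := funext fun w => conv_zero_right _ w f
        change (shift a (f * 1)) w = shift a f w
        rw [shift_mul, one_def, shift_const, h, add_zero]
        exact ih _
    mul_assoc := fun f g h => by
      have hr : ∀ f g h : WordSeries α R, (f + g) * h = f * h + g * h :=
        fun f g h => funext fun w => conv_add_left _ w f g h
      have hl : ∀ f g h : WordSeries α R, f * (g + h) = f * g + f * h :=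
        fun f g h => funext fun w => conv_add_right _ w f g h
      funext w
      induction w generalizing f g h with
      | nil => exact mul_assoc _ _ _
      | cons a w ih =>
        change (shift a (f * g * h)) w = (shift a (f * (g * h))) w
        simp only [shift_mul, hr, hl, add_apply, ih, add_assoc] }

theorem const_mul_const (a b : R) : (const a * const b : WordSeries α R) = const (a * b) :=
  funext fun w => conv_const _ w a b

theorem shift_mul_const (a : α) (f : WordSeries α R) (c : R) :
    shift a (f * const c) = shift a f * const c := by
  rw [shift_mul, shift_const, mul_zero, add_zero]

theorem mul_const_apply (f : WordSeries α R) (c : R) (w : List α) :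
    (f * const c : WordSeries α R) w = f w * c := by
  induction w generalizing f with
  | nil => rfl
  | cons a w ih =>
    change shift a (f * const c) w = _
    rw [shift_mul_const, ih]
    rfl

variable [Field K] [Algebra K R]

instance : Algebra K (WordSeries α R) :=
  Algebra.ofModule
    (fun c f g => funext fun w => conv_smul_left _ w (fun c a b => smul_mul_assoc c a b) c f g)
    (fun c f g => funext fun w => conv_smul_right _ w (fun c a b => mul_smul_comm c a b) c f g)

theorem mul_mem_lenFil {f g : WordSeries α R} {i j : ℕ} (hf : f ∈ lenFil K i)
    (hg : g ∈ lenFil K j) : f * g ∈ lenFil K (i + j) :=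
  fun w hw => conv_eq_zero _ w hf hg hw

theorem pow_mem_lenFil {f : WordSeries α R} (hf : f ∈ lenFil K 1) (k : ℕ) :
    f ^ k ∈ lenFil K k := by
  induction k with
  | zero => exact mem_lenFil_zero _
  | succ k ih => rw [pow_succ]; exact mul_mem_lenFil ih hf

end Ring

section Weighted

variable {K : Type u} {L : Type v} {A : Type w} [Field K] [AddCommGroup L] [Module K L]
  [AddCommGroup A] [Module K A]

/-- The submodule of series satisfying `IsWeighted`. -/
def weighted (F : ℕ → Submodule K L) (G : ℕ → Submodule K A) (k : ℕ) :
    Submodule K (WordSeries L A) where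
  carrier := {f | IsWeighted F G k f}
  zero_mem' := isWeighted_zero
  add_mem' := IsWeighted.add
  smul_mem' c _ hf := hf.smul c

theorem weighted_antitone {F : ℕ → Submodule K L} {G : ℕ → Submodule K A} (hG : Antitone G) :
    Antitone (weighted F G) := fun _ _ h _ hf l hl => hG (Nat.add_le_add_right h _) (hf l hl)

theorem apply_nil_mem {F : ℕ → Submodule K L} {G : ℕ → Submodule K A} {k : ℕ}
    {f : WordSeries L A} (hf : f ∈ weighted F G k) : f [] ∈ G k :=
  hf [] (by simp)

end Weighted

section DividedShift

variable {K : Type u} {α : Type v} {A : Type w} [Field K] [AddCommGroup A] [Module K A]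

variable (K) in
/-- The iterated shift divided by a factorial. -/
noncomputable def divShift (a : α) (p : ℕ) (f : WordSeries α A) : WordSeries α A :=
  ((p.factorial : K)⁻¹) • (shift a)^[p] f

variable (K) in
/-- The truncated exponential of a shift. -/
noncomputable def expShift (a : α) (n : ℕ) (f : WordSeries α A) : WordSeries α A :=
  ∑ p ∈ Finset.range n, divShift K a p f

theorem shift_smul (a : α) (c : K) (f : WordSeries α A) : shift a (c • f) = c • shift a f := rfl

theorem divShift_zero (a : α) (f : WordSeries α A) : divShift K a 0 f = f := by
  simp [divShift]

theorem succ_smul_divShift_succ [CharZero K] (a : α) (p : ℕ) (f : WordSeries α A) :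
    ((p + 1 : ℕ) : K) • divShift K a (p + 1) f = shift a (divShift K a p f) := by
  rw [divShift, succ_smul_factorial_inv_smul, Function.iterate_succ_apply', divShift, shift_smul]

theorem divShift_add (a : α) (p : ℕ) (f g : WordSeries α A) :
    divShift K a p (f + g) = divShift K a p f + divShift K a p g := by
  rw [divShift, divShift, divShift, ← smul_add, ← iterate_map_add]

theorem divShift_smul (a : α) (p : ℕ) (c : K) (f : WordSeries α A) :
    divShift K a p (c • f) = c • divShift K a p f := by
  rw [divShift, divShift, smul_comm]
  congr 1
  induction p with
  | zero => rfl
  | succ p ih => rw [Function.iterate_succ_apply', ih, Function.iterate_succ_apply', shift_smul]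

theorem expShift_add (a : α) (n : ℕ) (f g : WordSeries α A) :
    expShift K a n (f + g) = expShift K a n f + expShift K a n g := by
  simp only [expShift, divShift_add, Finset.sum_add_distrib]

theorem expShift_smul (a : α) (n : ℕ) (c : K) (f : WordSeries α A) :
    expShift K a n (c • f) = c • expShift K a n f := by
  simp only [expShift, divShift_smul, Finset.smul_sum]

theorem divShift_mem_lenFil (a : α) (p n : ℕ) {f : WordSeries α A} (hf : f ∈ lenFil K (n + p)) :
    divShift K a p f ∈ lenFil K n := by
  refine Submodule.smul_mem _ _ ?_
  induction p generalizing f with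
  | zero => exact hf
  | succ p ih => exact ih (shift_mem_lenFil a hf)

theorem divShift_mem_weighted {L : Type*} [AddCommGroup L] [Module K L] {F : ℕ → Submodule K L}
    {G : ℕ → Submodule K A} {x : L} (hx : x ∈ F 1) {k : ℕ} {f : WordSeries L A}
    (hf : f ∈ weighted F G k) (p : ℕ) : divShift K x p f ∈ weighted F G (k + p) := by
  refine Submodule.smul_mem _ _ ?_
  induction p generalizing k f with
  | zero => exact hf
  | succ p ih =>
    have h := ih (f := shift x f) (k := k + 1) (IsWeighted.shift hf hx)
    rwa [add_assoc, add_comm 1] at h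

theorem expShift_mem_weighted {L : Type*} [AddCommGroup L] [Module K L] {F : ℕ → Submodule K L}
    {G : ℕ → Submodule K A} (hG : Antitone G) {x : L} (hx : x ∈ F 1) {k : ℕ}
    {f : WordSeries L A} (hf : f ∈ weighted F G k) (n : ℕ) :
    expShift K x n f ∈ weighted F G k :=
  Submodule.sum_mem _ fun p _ =>
    weighted_antitone hG (Nat.le_add_right k p) (divShift_mem_weighted hx hf p)

open Finset in
theorem divShift_mul [CharZero K] {R : Type*} [Ring R] [Algebra K R] (a : α) (n : ℕ)
    (f g : WordSeries α R) : divShift K a n (f * g) =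
      ∑ p ∈ antidiagonal n, divShift K a p.1 f * divShift K a p.2 g := by
  induction n with
  | zero => simp [divShift_zero]
  | succ n ih =>
    refine smul_right_injective _ (r := ((n + 1 : ℕ) : K))
      (Nat.cast_ne_zero.2 n.succ_ne_zero) ?_
    have h := sum_antidiagonal_leibniz (LinearMap.mul K (WordSeries α R))
      (fun i => divShift K a i f) (fun i => divShift K a i g) n
    simp only [LinearMap.mul_apply', succ_smul_divShift_succ] at h
    change ((n + 1 : ℕ) : K) • divShift K a (n + 1) (f * g) = ((n + 1 : ℕ) : K) • _
    rw [h, succ_smul_divShift_succ, ih, map_sum]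
    exact sum_congr rfl fun p _ => shift_mul _ _ _

end DividedShift

end WordSeries

/-! ### Evaluation of word series at exp x exp y -/

namespace WordSeries

section ExpShift

variable {K : Type u} {L : Type v} {R : Type w} [Field K] [CharZero K] [AddCommGroup L]
  [Module K L] [Ring R] [Algebra K R] {F : ℕ → Submodule K L} {G : ℕ → Submodule K R}

omit [CharZero K] in
theorem mul_mem_weighted (hG : ∀ i j, ∀ a ∈ G i, ∀ b ∈ G j, a * b ∈ G (i + j)) {i j : ℕ}
    {f g : WordSeries L R} (hf : f ∈ weighted F G i) (hg : g ∈ weighted F G j) :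
    f * g ∈ weighted F G (i + j) :=
  show IsWeighted F G (i + j) _ from
    IsWeighted.conv (AddMonoidHom.mul : R →+ R →+ R) hG hf hg

omit [CharZero K] in
theorem pow_mem_weighted (hG : ∀ i j, ∀ a ∈ G i, ∀ b ∈ G j, a * b ∈ G (i + j))
    (h1 : (1 : R) ∈ G 0) {f : WordSeries L R} (hf : f ∈ weighted F G 0) (k : ℕ) :
    f ^ k ∈ weighted F G 0 := by
  induction k with
  | zero => rw [pow_zero]; exact isWeighted_const h1
  | succ k ih => rw [pow_succ]; exact mul_mem_weighted hG ih hf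

/-- On weighted series, `expShift` is multiplicative up to terms of high weight. -/
theorem expShift_mul_sub_mem (hGa : Antitone G)
    (hG : ∀ i j, ∀ a ∈ G i, ∀ b ∈ G j, a * b ∈ G (i + j)) {x : L} (hx : x ∈ F 1)
    {f g : WordSeries L R} (hf : f ∈ weighted F G 0) (hg : g ∈ weighted F G 0) (n : ℕ) :
    expShift K x n (f * g) - expShift K x n f * expShift K x n g ∈ weighted F G n := by
  have h := sum_antidiagonal_sub_mem (weighted F G n)
    (fun i j => divShift K x i f * divShift K x j g) n fun i j hij => by
      have hi := divShift_mem_weighted hx hf i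
      have hj := divShift_mem_weighted hx hg j
      rw [zero_add] at hi hj
      exact weighted_antitone hGa hij (mul_mem_weighted hG hi hj)
  simp only [expShift, divShift_mul, Finset.sum_mul_sum]
  exact h

variable (K) in
/-- The value of a series on the truncation of `exp x * exp y`. -/
noncomputable def expEval {A : Type*} [AddCommGroup A] [Module K A] (x y : L) (n : ℕ)
    (f : WordSeries L A) : A :=
  expShift K x n (expShift K y n f) []

omit [CharZero K] [AddCommGroup L] [Module K L] in
theorem expEval_add {A : Type*} [AddCommGroup A] [Module K A] (x y : L) (n : ℕ)
    (f g : WordSeries L A) : expEval K x y n (f + g) = expEval K x y n f + expEval K x y n g := by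
  rw [expEval, expShift_add, expShift_add]; rfl

omit [CharZero K] [AddCommGroup L] [Module K L] in
theorem expEval_smul {A : Type*} [AddCommGroup A] [Module K A] (x y : L) (n : ℕ) (c : K)
    (f : WordSeries L A) : expEval K x y n (c • f) = c • expEval K x y n f := by
  rw [expEval, expShift_smul, expShift_smul]; rfl

/-- The element exp x exp y is group-like: exponentials of derivations are multiplicative, and the
error of truncation involves at least `n` letters from `F 1`. -/
theorem expEval_mul_sub_mem (hGa : Antitone G)
    (hG : ∀ i j, ∀ a ∈ G i, ∀ b ∈ G j, a * b ∈ G (i + j)) {x y : L} (hx : x ∈ F 1)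
    (hy : y ∈ F 1) {f g : WordSeries L R} (hf : f ∈ weighted F G 0) (hg : g ∈ weighted F G 0)
    (n : ℕ) : expEval K x y n (f * g) - expEval K x y n f * expEval K x y n g ∈ G n := by
  have hf' := expShift_mem_weighted hGa hy hf n
  have hg' := expShift_mem_weighted hGa hy hg n
  have h1 := expShift_mem_weighted hGa hx (expShift_mul_sub_mem hGa hG hy hf hg n) n
  have h2 := expShift_mul_sub_mem hGa hG hx hf' hg' n
  have h3 : expShift K x n (expShift K y n (f * g)) =
      expShift K x n (expShift K y n (f * g) - expShift K y n f * expShift K y n g) +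
      expShift K x n (expShift K y n f * expShift K y n g) := by
    rw [← expShift_add, sub_add_cancel]
  have h4 := apply_nil_mem ((weighted F G n).add_mem h1 h2)
  rw [← add_sub_assoc, ← h3] at h4
  exact h4

omit [CharZero K] in
theorem expEval_mem {A : Type*} [AddCommGroup A] [Module K A] {G : ℕ → Submodule K A}
    (hGa : Antitone G) {x y : L} (hx : x ∈ F 1)
    (hy : y ∈ F 1) {k : ℕ} {f : WordSeries L A} (hf : f ∈ weighted F G k) (n : ℕ) :
    expEval K x y n f ∈ G k :=
  apply_nil_mem (expShift_mem_weighted hGa hx (expShift_mem_weighted hGa hy hf n) n)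

omit [CharZero K] in
-- The terms with `p + q < n` evaluate `f` on words that are too short and vanish; the others have
-- weight at least `n`.
theorem expEval_mem_of_mem_lenFil {A : Type*} [AddCommGroup A] [Module K A]
    {G : ℕ → Submodule K A} (hGa : Antitone G) {x y : L} (hx : x ∈ F 1)
    (hy : y ∈ F 1) {f : WordSeries L A} (hf : f ∈ weighted F G 0) {n : ℕ}
    (hn : f ∈ lenFil K n) : expEval K x y n f ∈ G n := by
  have h : expEval K x y n f = ∑ p ∈ Finset.range n, ∑ q ∈ Finset.range n,
      divShift K x p (divShift K y q f) [] := by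
    have hadd : ∀ p, divShift K x p (expShift K y n f) =
        ∑ q ∈ Finset.range n, divShift K x p (divShift K y q f) := fun p =>
      map_sum (AddMonoidHom.mk' (divShift K x p) (divShift_add x p)) _ _
    rw [expEval, expShift, sum_apply]
    exact Finset.sum_congr rfl fun p _ => by rw [hadd, sum_apply]
  rw [h]
  refine Submodule.sum_mem _ fun p _ => Submodule.sum_mem _ fun q _ => ?_
  by_cases hpq : p + q < n
  · have h1 : divShift K x p (divShift K y q f) ∈ lenFil K (n - q - p) :=
      divShift_mem_lenFil x p _ (divShift_mem_lenFil y q _ (lenFil_antitone (by omega) hn))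
    rw [h1 [] (by rw [List.length_nil]; omega)]
    exact Submodule.zero_mem _
  · have h1 := divShift_mem_weighted hx (divShift_mem_weighted hy hf q) p
    exact hGa (by omega) (apply_nil_mem h1)

omit [CharZero K] in
theorem expEval_succ_sub_mem {A : Type*} [AddCommGroup A] [Module K A] {G : ℕ → Submodule K A}
    (hGa : Antitone G) {x y : L} (hx : x ∈ F 1)
    (hy : y ∈ F 1) {f : WordSeries L A} (hf : f ∈ weighted F G 0) (n : ℕ) :
    expEval K x y (n + 1) f - expEval K x y n f ∈ G n := by
  have hsucc : ∀ (x : L) (g : WordSeries L A),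
      expShift K x (n + 1) g = expShift K x n g + divShift K x n g := fun x g =>
    Finset.sum_range_succ _ _
  have h1 := divShift_mem_weighted hy hf n
  have h2 := divShift_mem_weighted hx (expShift_mem_weighted hGa hy hf (n + 1)) n
  rw [zero_add] at h1 h2
  have h3 := apply_nil_mem ((weighted F G n).add_mem (expShift_mem_weighted hGa hx h1 n) h2)
  have h4 : expEval K x y (n + 1) f = expEval K x y n f +
      (expShift K x n (divShift K y n f) + divShift K x n (expShift K y (n + 1) f)) [] := by
    rw [expEval, hsucc x, hsucc y f, expShift_add, expEval, add_assoc]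
    rfl
  rwa [h4, add_sub_cancel_left]

end ExpShift

/-! ### The exponential of `logWords` over the enveloping algebra -/

section Enveloping

open UniversalEnvelopingAlgebra

variable {K : Type u} {L : Type v} [Field K] [LieRing L] [LieAlgebra K L]

variable (K) in
/-- A series with values in `L`, viewed as a series with values in the enveloping algebra. -/
noncomputable def toEnveloping :
    WordSeries L L →ₗ[K] WordSeries L (UniversalEnvelopingAlgebra K L) where
  toFun f := fun w => ι K (f w)
  map_add' f g := funext fun w => map_add (ι K) (f w) (g w)
  map_smul' c f := funext fun w => map_smul (ι K) c (f w)

theorem toEnveloping_apply (f : WordSeries L L) (w : List L) :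
    toEnveloping K f w = ι K (f w) := rfl

theorem shift_toEnveloping (x : L) (f : WordSeries L L) :
    shift x (toEnveloping K f) = toEnveloping K (shift x f) := rfl

theorem toEnveloping_const (x : L) : toEnveloping K (const x) = const (ι K x) := by
  funext w
  cases w with
  | nil => rfl
  | cons a w => exact map_zero (ι K)

theorem toEnveloping_mem_lenFil {f : WordSeries L L} {n : ℕ} (hf : f ∈ lenFil K n) :
    toEnveloping K f ∈ lenFil K n := fun w hw => by
  rw [toEnveloping_apply, hf w hw, map_zero]

attribute [local instance 100] LieRing.ofAssociativeRing

theorem toEnveloping_lie (f g : WordSeries L L) :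
    toEnveloping K ⁅f, g⁆ =
      toEnveloping K f * toEnveloping K g - toEnveloping K g * toEnveloping K f := by
  funext w
  induction w generalizing f g with
  | nil => exact (LieHom.map_lie (ι K) (f []) (g [])).trans (Ring.lie_def _ _)
  | cons a w ih =>
    change shift a (toEnveloping K ⁅f, g⁆) w = shift a (_ - _) w
    rw [shift_toEnveloping, shift_lie, map_add, add_apply, ih, ih, map_sub, shift_mul, shift_mul]
    simp only [sub_apply, add_apply, shift_toEnveloping]
    abel

variable (K L) in
/-- The exponential of `logWords`, mapping a word `xₙ ⋯ x₁` to the product `x₁ ⋯ xₙ`. -/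
noncomputable def expWords : WordSeries L (UniversalEnvelopingAlgebra K L) :=
  fun w => (w.reverse.map (ι K)).prod

theorem shift_expWords (x : L) : shift x (expWords K L) = expWords K L * const (ι K x) := by
  funext w
  rw [mul_const_apply, shift_apply, expWords, List.reverse_cons, List.map_append,
    List.prod_append, List.map_singleton, List.prod_singleton]
  rfl

theorem expWords_nil : expWords K L [] = 1 := List.prod_nil

variable [CharZero K]

/-- Both series are 1 at the empty word and satisfy ∂ₓE = E x, the first by the derivative of the
exponential and `hasTheta_logWords`, the second by `shift_expWords`. Shifting lowers the length by
one, which drives the induction. -/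
theorem expSum_logWords_sub_expWords_mem (n : ℕ) :
    expSum K (toEnveloping K (logWords K L)) n - expWords K L ∈ lenFil K n := by
  induction n with
  | zero => exact mem_lenFil_zero _
  | succ n ih =>
    set z := toEnveloping K (logWords K L) with hz
    have hz1 : z ∈ lenFil K 1 := toEnveloping_mem_lenFil logWords_mem_lenFil
    refine mem_lenFil_succ ?_ fun x => ?_
    · have hr : ∑ k ∈ Finset.range n, (((k + 1).factorial : K)⁻¹) • z ^ (k + 1) ∈ lenFil K 1 :=
        Submodule.sum_mem _ fun k _ => Submodule.smul_mem _ _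
          (lenFil_antitone (by omega) (pow_mem_lenFil hz1 (k + 1)))
      rw [expSum, Finset.sum_range_succ', sub_apply, add_apply, hr [] zero_lt_one, expWords_nil]
      simp [one_def, const]
    · set Y : ℕ → WordSeries L (UniversalEnvelopingAlgebra K L) := fun k =>
        toEnveloping K (adTerm (K := K) (logWords K L) k (shift x (logWords K L))) with hY
      have hder := derivation_pow_div_factorial (K := K) (shift x) (shift_mul x)
        (shift_smul x) (z := z) (Y := Y) rfl fun k => by
          simp only [hY]
          rw [← map_smul, smul_adTerm_succ, map_neg, toEnveloping_lie]
          abel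
      have h0 : shift x (expSum K z (n + 1)) = ∑ m ∈ Finset.range n,
          ∑ p ∈ Finset.HasAntidiagonal.antidiagonal m, ((p.1.factorial : K)⁻¹ • z ^ p.1) * Y p.2 := by
        rw [expSum, Finset.sum_range_succ', map_add, map_sum, Finset.sum_congr rfl fun m _ => hder m]
        simp [one_def, shift_const]
      have h1 := sum_antidiagonal_sub_mem (lenFil K n)
        (fun i j => ((i.factorial : K)⁻¹ • z ^ i) * Y j) n fun i j hij =>
          lenFil_antitone hij (mul_mem_lenFil (Submodule.smul_mem _ _ (pow_mem_lenFil hz1 i))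
            (toEnveloping_mem_lenFil (adTerm_mem_lenFil_self logWords_mem_lenFil _ j)))
      rw [← h0, ← Finset.sum_mul_sum] at h1
      have h2 : ∑ j ∈ Finset.range n, Y j - const (ι K x) ∈ lenFil K n := by
        have h := toEnveloping_mem_lenFil (hasTheta_logWords (K := K) x n)
        rwa [map_sub, map_sum, toEnveloping_const] at h
      have h3 := mul_mem_lenFil (mem_lenFil_zero (K := K)
        (∑ k ∈ Finset.range n, ((k.factorial : K)⁻¹) • z ^ k)) h2
      have h4 := mul_mem_lenFil ih (mem_lenFil_zero (K := K) (const (ι K x)))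
      rw [zero_add] at h3
      rw [add_zero] at h4
      have h5 := Submodule.add_mem _ (Submodule.add_mem _ h1 h3) h4
      rw [map_sub, shift_expWords]
      convert h5 using 1
      simp only [expSum]
      noncomm_ring

omit [CharZero K] in
theorem expShift_expWords_mul_const (x : L) (n : ℕ) (c : UniversalEnvelopingAlgebra K L) :
    expShift K x n (expWords K L * const c) = expWords K L * const (expSum K (ι K x) n * c) := by
  have h : ∀ p, (shift x)^[p] (expWords K L * const c) =
      expWords K L * const (ι K x ^ p * c) := by
    intro p
    induction p with
    | zero => simp
    | succ p ih =>
      rw [Function.iterate_succ_apply', ih, shift_mul_const, shift_expWords, mul_assoc,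
        const_mul_const, ← mul_assoc, ← pow_succ']
  have hs : const (expSum K (ι K x) n * c) = ∑ p ∈ Finset.range n,
      (p.factorial : K)⁻¹ • (const (ι K x ^ p * c) : WordSeries L _) := by
    rw [expSum, Finset.sum_mul]
    induction n with
    | zero => exact const_zero
    | succ n ih =>
      rw [Finset.sum_range_succ, const_add, ih, Finset.sum_range_succ, smul_mul_assoc,
        const_smul (K := K)]
  rw [expShift, hs, Finset.mul_sum]
  exact Finset.sum_congr rfl fun p _ => by rw [divShift, h, mul_smul_comm]

omit [CharZero K] in
theorem expEval_expWords (x y : L) (n : ℕ) :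
    expEval K x y n (expWords K L) = expSum K (ι K x) n * expSum K (ι K y) n := by
  have h := expShift_expWords_mul_const (K := K) y n (1 : UniversalEnvelopingAlgebra K L)
  rw [← one_def, mul_one, mul_one] at h
  rw [expEval, h, expShift_expWords_mul_const, mul_const_apply, expWords_nil, one_mul]

omit [CharZero K] in
theorem expEval_toEnveloping (x y : L) (n : ℕ) (f : WordSeries L L) :
    expEval K x y n (toEnveloping K f) = ι K (expEval K x y n f) := by
  have h : ∀ (x : L) (f : WordSeries L L),
      expShift K x n (toEnveloping K f) = toEnveloping K (expShift K x n f) := by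
    intro x f
    rw [expShift, expShift, map_sum]
    refine Finset.sum_congr rfl fun p hp => ?_
    clear hp
    rw [divShift, divShift, map_smul]
    congr 1
    induction p with
    | zero => rfl
    | succ p ih =>
      rw [Function.iterate_succ_apply', ih, Function.iterate_succ_apply', shift_toEnveloping]
  rw [expEval, h, h, toEnveloping_apply, expEval]

end Enveloping

end WordSeries

/-! ### The Baker-Campbell-Hausdorff theorem in a complete filtered Lie algebra -/

section Existence

open UniversalEnvelopingAlgebra WordSeries

variable {K : Type u} {L : Type v} [Field K] [CharZero K] [LieRing L] [LieAlgebra K L]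
  {F : ℕ → Submodule K L}

omit [CharZero K] in
theorem mul_mem_envelopingFiltration (h0 : F 0 = ⊤) {m n : ℕ}
    {a b : UniversalEnvelopingAlgebra K L} (ha : a ∈ envelopingFiltration F m)
    (hb : b ∈ envelopingFiltration F n) : a * b ∈ envelopingFiltration F (m + n) := by
  rw [mem_envelopingFiltration_iff h0] at ha hb ⊢
  exact span_weightedProducts_mul_mem ha hb

omit [CharZero K] in
theorem list_prod_mem_envelopingFiltration (l : List (ℕ × L)) (hl : ∀ p ∈ l, p.2 ∈ F p.1) :
    (l.map fun p => ι K p.2).prod ∈ envelopingFiltration F (l.map Prod.fst).sum :=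
  TwoSidedIdeal.mem_asIdeal.2 (TwoSidedIdeal.subset_span ⟨l, hl, le_rfl, rfl⟩)

omit [CharZero K] in
theorem ι_mem_envelopingFiltration {n : ℕ} {x : L} (hx : x ∈ F n) :
    ι K x ∈ envelopingFiltration F n := by
  have h := list_prod_mem_envelopingFiltration [(n, x)] (F := F) (by simpa using hx)
  simpa using h

/-- The Baker-Campbell-Hausdorff theorem, modulo each step of the filtration. -/
theorem expSum_expEval_logWords_sub_mem (hF : IsCompleteFilteredLieAlgebra F) {x y : L}
    (hx : x ∈ F 1) (hy : y ∈ F 1) (n : ℕ) :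
    expSum K (ι K (expEval K x y (n + 1) (logWords K L))) (n + 1) -
      expSum K (ι K x) (n + 1) * expSum K (ι K y) (n + 1) ∈ envelopingFiltration F (n + 1) := by
  let G : ℕ → Submodule K (UniversalEnvelopingAlgebra K L) :=
    fun n => (envelopingFiltration F n).restrictScalars K
  have hGa : Antitone G := fun m n h => envelopingFiltration_antitone F h
  have hG : ∀ i j, ∀ a ∈ G i, ∀ b ∈ G j, a * b ∈ G (i + j) :=
    fun i j a ha b hb => mul_mem_envelopingFiltration hF.zero_eq_top ha hb
  have h1 : (1 : UniversalEnvelopingAlgebra K L) ∈ G 0 :=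
    list_prod_mem_envelopingFiltration [] (by simp)
  set z := toEnveloping K (logWords K L) with hz
  have hzw : z ∈ weighted F G 0 := fun l hl =>
    ι_mem_envelopingFiltration (logWords_isWeighted hF.lie_mem l hl)
  have hEw : expWords K L ∈ weighted F G 0 := by
    intro l hl
    have h := list_prod_mem_envelopingFiltration l.reverse
      (fun p hp => hl p (List.mem_reverse.1 hp))
    rw [List.map_reverse, List.map_reverse, List.sum_reverse] at h
    rw [zero_add, expWords, ← List.map_reverse, List.map_map, List.map_reverse]
    exact h
  -- Multiplicativity of the evaluation modulo `G (n + 1)` extends to powers, and from there to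
  -- truncated exponentials.
  have hpow : ∀ k, expEval K x y (n + 1) (z ^ k) - expEval K x y (n + 1) z ^ k ∈ G (n + 1) := by
    intro k
    induction k with
    | zero =>
      have hc : ∀ (x : L) (p : ℕ), (shift x)^[p + 1]
          (1 : WordSeries L (UniversalEnvelopingAlgebra K L)) = 0 := fun x p => by
        rw [Function.iterate_succ_apply, one_def, shift_const]
        exact iterate_map_zero _ _
      have h : ∀ x : L, expShift K x (n + 1)
          (1 : WordSeries L (UniversalEnvelopingAlgebra K L)) = 1 := fun x => by
        rw [expShift, Finset.sum_range_succ', divShift_zero, Finset.sum_eq_zero, zero_add]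
        intro p _
        rw [divShift, hc, smul_zero]
      rw [pow_zero, pow_zero, expEval, h, h]
      simp [one_def, const]
    | succ k ih =>
      have h2 := expEval_mul_sub_mem hGa hG hx hy (pow_mem_weighted hG h1 hzw k) hzw (n + 1)
      have h3 := hG _ _ _ ih _ (expEval_mem hGa hx hy hzw (n + 1))
      have h4 := (G (n + 1)).add_mem h2 h3
      rw [pow_succ, pow_succ]
      convert h4 using 1
      noncomm_ring
  have h2 : expEval K x y (n + 1) (expSum K z (n + 1)) -
      expSum K (expEval K x y (n + 1) z) (n + 1) ∈ G (n + 1) := by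
    have h : expEval K x y (n + 1) (expSum K z (n + 1)) = ∑ k ∈ Finset.range (n + 1),
        (k.factorial : K)⁻¹ • expEval K x y (n + 1) (z ^ k) := by
      have := map_sum (AddMonoidHom.mk' (expEval K x y (n + 1) :
        WordSeries L (UniversalEnvelopingAlgebra K L) → _) (expEval_add x y (n + 1)))
        (fun k => (k.factorial : K)⁻¹ • z ^ k) (Finset.range (n + 1))
      refine this.trans (Finset.sum_congr rfl fun k _ => expEval_smul _ _ _ _ _)
    rw [h, expSum, ← Finset.sum_sub_distrib]
    refine Submodule.sum_mem _ fun k _ => ?_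
    rw [← smul_sub]
    exact Submodule.smul_mem _ _ (hpow k)
  have h3 : expEval K x y (n + 1) (expSum K z (n + 1) - expWords K L) ∈ G (n + 1) := by
    refine expEval_mem_of_mem_lenFil hGa hx hy (Submodule.sub_mem _ ?_ hEw)
      (expSum_logWords_sub_expWords_mem (n + 1))
    exact Submodule.sum_mem _ fun k _ => Submodule.smul_mem _ _ (pow_mem_weighted hG h1 hzw k)
  have h4 : expEval K x y (n + 1) (expSum K z (n + 1)) =
      expEval K x y (n + 1) (expSum K z (n + 1) - expWords K L) +
      expSum K (ι K x) (n + 1) * expSum K (ι K y) (n + 1) := by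
    rw [← expEval_expWords, ← expEval_add, sub_add_cancel]
  have h5 := (G (n + 1)).sub_mem h3 h2
  rw [h4, expEval_toEnveloping] at h5
  change _ ∈ G (n + 1)
  convert h5 using 1
  abel

/-- There is an element of the Lie algebra representing `log (exp x * exp y)`. -/
theorem exists_expSum_sub_mem (hF : IsCompleteFilteredLieAlgebra F) {x y : L}
    (hx : x ∈ F 1) (hy : y ∈ F 1) : ∃ c ∈ F 1, ∀ n, expSum K (ι K c) (n + 1) -
      expSum K (ι K x) (n + 1) * expSum K (ι K y) (n + 1) ∈ envelopingFiltration F (n + 1) := by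
  have hw : logWords K L ∈ weighted F F 0 := logWords_isWeighted hF.lie_mem
  obtain ⟨c, hc, -⟩ := hF.complete (fun n => expEval K x y n (logWords K L))
    (expEval_succ_sub_mem hF.antitone hx hy hw)
  refine ⟨c, ?_, fun n => ?_⟩
  · have h := hc 1
    -- With one term of each exponential the evaluation is at the empty word, where `logWords`
    -- vanishes; this puts the limit in `F 1`.
    have h0 : expEval K x y 1 (logWords K L) = 0 := by
      have h1 : ∀ (x : L) (f : WordSeries L L), expShift K x 1 f = f := fun x f => by
        rw [expShift, Finset.sum_range_one, divShift_zero]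
      rw [expEval, h1, h1]
      exact logWords_mem_lenFil (K := K) [] zero_lt_one
    rwa [h0, sub_zero] at h
  · have h1 := expSum_expEval_logWords_sub_mem hF hx hy n
    have h2 := ι_mem_envelopingFiltration (hc (n + 1))
    rw [map_sub] at h2
    rw [← Ideal.Quotient.eq] at h1 h2 ⊢
    rw [← h1, expSum, expSum]
    have hs : ∀ a : UniversalEnvelopingAlgebra K L, ∀ r : K,
        Ideal.Quotient.mk (envelopingFiltration F (n + 1)) (r • a) =
          r • Ideal.Quotient.mk (envelopingFiltration F (n + 1)) a := fun a r => rfl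
    simp only [map_sum, hs, map_pow, h2]

end Existence

/-! ### The completed enveloping algebra and the Lie case -/

section CompletedEnveloping

open UniversalEnvelopingAlgebra

variable {K : Type u} {L : Type v} [Field K] [LieRing L] [LieAlgebra K L]
  {F : ℕ → Submodule K L}

theorem mem_completedFiltration {n : ℕ} {f : completedEnveloping F} :
    f ∈ completedFiltration F n ↔ f.1 n = 0 := Iff.rfl

theorem completedFiltration_isCompleteFilteredAlgebra (h0 : F 0 = ⊤) :
    IsCompleteFilteredAlgebra (completedFiltration F) where
  zero_eq_top := by
    refine eq_top_iff.2 fun f _ => ?_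
    obtain ⟨u, hu⟩ := Ideal.Quotient.mk_surjective (f.1 0)
    rw [mem_completedFiltration, ← hu, Ideal.Quotient.eq_zero_iff_mem,
      mem_envelopingFiltration_iff h0, span_weightedProducts_zero h0]
    trivial
  antitone m n h f hf := by
    rw [mem_completedFiltration] at hf ⊢
    rw [← f.2 m n h, hf, map_zero]
  complete x hx := by
    have hx' : ∀ m k, (x (m + k)).1 m = (x m).1 m := by
      intro m k
      induction k with
      | zero => rfl
      | succ k ih =>
        have h1 : (x (m + k + 1) - x (m + k)).1 (m + k) = 0 := hx (m + k)
        have h2 := (x (m + k + 1) - x (m + k)).2 m (m + k) (Nat.le_add_right m k)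
        rw [h1, map_zero] at h2
        exact (sub_eq_zero.1 h2.symm).trans ih
    -- The limit is the diagonal family: the component of index `m` no longer changes from `x m` on.
    refine ⟨⟨fun n => (x n).1 n, fun m n h => ?_⟩, fun n => sub_self _, fun y hy => ?_⟩
    · obtain ⟨k, rfl⟩ := Nat.exists_eq_add_of_le h
      exact ((x (m + k)).2 m (m + k) h).trans (hx' m k)
    · exact Subtype.ext (funext fun n => sub_eq_zero.1 (hy n))
  mul_mem m n a ha b hb := by
    rw [mem_completedFiltration] at ha hb ⊢
    obtain ⟨u, hu⟩ := Ideal.Quotient.mk_surjective (a.1 (m + n))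
    obtain ⟨v, hv⟩ := Ideal.Quotient.mk_surjective (b.1 (m + n))
    have ha' := a.2 m (m + n) (Nat.le_add_right m n)
    have hb' := b.2 n (m + n) (Nat.le_add_left n m)
    rw [ha, ← hu] at ha'
    rw [hb, ← hv] at hb'
    have h1 := Ideal.Quotient.eq_zero_iff_mem.1 ha'
    have h2 := Ideal.Quotient.eq_zero_iff_mem.1 hb'
    change a.1 (m + n) * b.1 (m + n) = 0
    rw [← hu, ← hv, ← map_mul, Ideal.Quotient.eq_zero_iff_mem]
    exact mul_mem_envelopingFiltration h0 h1 h2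

theorem toCompleted_sub (x y : L) :
    toCompleted F (x - y) = toCompleted F x - toCompleted F y :=
  Subtype.ext (funext fun n => by
    change Ideal.Quotient.mkₐ K _ (ι K (x - y)) = _
    rw [map_sub, map_sub]
    rfl)

theorem toCompleted_mem {n : ℕ} {x : L} (hx : x ∈ F n) :
    toCompleted F x ∈ completedFiltration F n :=
  Ideal.Quotient.eq_zero_iff_mem.2 (ι_mem_envelopingFiltration hx)

theorem mem_of_toCompleted_mem [CharZero K] (hF : IsCompleteFilteredLieAlgebra F) {n : ℕ} {x : L}
    (hx : toCompleted F x ∈ completedFiltration F n) : x ∈ F n :=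
  mem_of_ι_mem_envelopingFiltration hF (Ideal.Quotient.eq_zero_iff_mem.1 hx)

theorem toCompleted_injective [CharZero K] (hF : IsCompleteFilteredLieAlgebra F) :
    Function.Injective (toCompleted F) := fun x y hxy => by
  refine hF.eq_of_forall_sub_mem fun n => mem_of_toCompleted_mem hF ?_
  rw [toCompleted_sub, hxy, sub_self]
  exact Submodule.zero_mem _

theorem powSucc_apply (a : completedEnveloping F) (k n : ℕ) :
    (powSucc a k).1 n = a.1 n ^ (k + 1) := by
  induction k with
  | zero => exact (pow_one _).symm
  | succ k ih =>
    change (powSucc a k).1 n * a.1 n = _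
    rw [ih, ← pow_succ]

variable [CharZero K]

omit [CharZero K] in
theorem lieExp_apply (hF : IsCompleteFilteredLieAlgebra F) {x : L} (hx : x ∈ F 1) (n : ℕ) :
    (lieExp F x).1 n = Ideal.Quotient.mk (envelopingFiltration F n) (expSum K (ι K x) (n + 1)) := by
  have hA := completedFiltration_isCompleteFilteredAlgebra hF.zero_eq_top
  have h := hA.antitone n.le_succ
    (seriesLim_sub_mem hA (fun k => ((k + 1).factorial : K)⁻¹) (toCompleted_mem hx) n)
  rw [← expSubOne_eq_seriesLim, mem_completedFiltration] at h
  have h1 : (expSubOne (completedFiltration F) (toCompleted F x)).1 n =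
      (seriesSum (fun k => ((k + 1).factorial : K)⁻¹) (toCompleted F x) n).1 n :=
    sub_eq_zero.1 h
  let π : completedEnveloping F →ₐ[K] UniversalEnvelopingAlgebra K L ⧸ envelopingFiltration F n :=
    (Pi.evalAlgHom K _ n).comp (completedEnveloping F).val
  have h2 : π (seriesSum (fun k => ((k + 1).factorial : K)⁻¹) (toCompleted F x) n) =
      ∑ k ∈ Finset.range n, ((k + 1).factorial : K)⁻¹ •
        Ideal.Quotient.mkₐ K (envelopingFiltration F n) (ι K x) ^ (k + 1) := by
    rw [seriesSum, map_sum]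
    refine Finset.sum_congr rfl fun k _ => ?_
    rw [map_smul]
    congr 1
    exact powSucc_apply _ _ _
  change 1 + (expSubOne (completedFiltration F) (toCompleted F x)).1 n =
    Ideal.Quotient.mkₐ K (envelopingFiltration F n) _
  rw [h1, expSum, Finset.sum_range_succ', map_add, map_sum]
  refine (congrArg (1 + ·) h2).trans ?_
  simp only [map_smul, map_pow, Nat.factorial_zero, Nat.cast_one, inv_one, one_smul, pow_zero,
    map_one]
  rw [add_comm]

/-- The element of `exists_expSum_sub_mem` has exponential exp x exp y in every quotient, hence in
the completion, where the logarithm recovers it. -/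
theorem exists_toCompleted_eq_hausdorff (hF : IsCompleteFilteredLieAlgebra F) {x y : L}
    (hx : x ∈ F 1) (hy : y ∈ F 1) : ∃ z ∈ F 1, toCompleted F z =
      hausdorff (completedFiltration F) (toCompleted F x) (toCompleted F y) := by
  have hA := completedFiltration_isCompleteFilteredAlgebra hF.zero_eq_top
  obtain ⟨c, hc, h⟩ := exists_expSum_sub_mem hF hx hy
  have hexp : lieExp F c = lieExp F x * lieExp F y := by
    refine Subtype.ext (funext fun n => ?_)
    change (lieExp F c).1 n = (lieExp F x).1 n * (lieExp F y).1 n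
    rw [lieExp_apply hF hc, lieExp_apply hF hx, lieExp_apply hF hy, ← map_mul, Ideal.Quotient.eq]
    exact envelopingFiltration_antitone F n.le_succ (h n)
  refine ⟨c, hc, ?_⟩
  have hexp' : expSubOne (completedFiltration F) (toCompleted F c) =
      expSubOne (completedFiltration F) (toCompleted F x) +
      expSubOne (completedFiltration F) (toCompleted F y) +
      expSubOne (completedFiltration F) (toCompleted F x) *
      expSubOne (completedFiltration F) (toCompleted F y) := by
    refine add_left_cancel (a := 1) ?_
    rw [lieExp, lieExp, lieExp] at hexp
    rw [hexp]
    noncomm_ring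
  rw [hausdorff, ← hexp', logOneAdd_expSubOne hA (toCompleted_mem hc)]

theorem lieHausdorff_spec (hF : IsCompleteFilteredLieAlgebra F) {x y : L} (hx : x ∈ F 1)
    (hy : y ∈ F 1) : lieHausdorff F x y ∈ F 1 ∧ toCompleted F (lieHausdorff F x y) =
      hausdorff (completedFiltration F) (toCompleted F x) (toCompleted F y) := by
  have h := exists_toCompleted_eq_hausdorff hF hx hy
  rw [lieHausdorff, dif_pos h]
  exact h.choose_spec

/-- Since the filtration of `L` is induced from the completed enveloping algebra, the estimate can
be checked there, where it is the associative one. -/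
theorem lieHausdorff_isContractingProduct (hF : IsCompleteFilteredLieAlgebra F) :
    IsContractingProduct F (lieHausdorff F) where
  mem x hx y hy := (lieHausdorff_spec hF hx hy).1
  bch_sub_mem n x hx x' hx' y hy y' hy' hxx hyy := by
    have hA := completedFiltration_isCompleteFilteredAlgebra hF.zero_eq_top
    have hbch : ∀ {x y : L}, x ∈ F 1 → y ∈ F 1 → toCompleted F (bch (lieHausdorff F) x y) =
        bch (hausdorff (completedFiltration F)) (toCompleted F x) (toCompleted F y) := by
      intro x y hx hy
      rw [bch, toCompleted_sub, toCompleted_sub, (lieHausdorff_spec hF hx hy).2, bch]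
    refine mem_of_toCompleted_mem hF ?_
    rw [toCompleted_sub, hbch hx hy, hbch hx' hy']
    refine (hausdorff_isContractingProduct hA).bch_sub_mem n _ (toCompleted_mem hx) _
      (toCompleted_mem hx') _ (toCompleted_mem hy) _ (toCompleted_mem hy') ?_ ?_
    · rw [← toCompleted_sub]; exact toCompleted_mem hxx
    · rw [← toCompleted_sub]; exact toCompleted_mem hyy

theorem factorizationAndUniformization_lieHausdorff (hF : IsCompleteFilteredLieAlgebra F)
    {P : L →ₗ[K] L} (hPP : P ∘ₗ P = P) (hP : ∀ n, ∀ a ∈ F n, P a ∈ F n) :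
    FactorizationAndUniformization F P (lieHausdorff F) (lieExp F) := by
  have hA := completedFiltration_isCompleteFilteredAlgebra hF.zero_eq_top
  refine factorizationAndUniformization_of_isContractingProduct hPP hF.toIsCompleteFiltration
    (lieHausdorff_isContractingProduct hF) hP (fun x hx y hy h => ?_) fun x hx y hy => ?_
  · exact toCompleted_injective hF (expSubOne_injOn hA (toCompleted_mem hx) (toCompleted_mem hy)
      (add_left_cancel h))
  · rw [lieExp, (lieHausdorff_spec hF hx hy).2,
      expSubOne_hausdorff hA (toCompleted_mem hx) (toCompleted_mem hy), lieExp, lieExp]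
    noncomm_ring

end CompletedEnveloping

end BCHFactorization

theorem mainTheorem1 {K : Type*} [Field K] [CharZero K] :
    -- associative algebras; the exponentials are taken in a unital algebra `B` containing `A`
    (∀ {A : Type*} [NonUnitalRing A] [Module K A] [IsScalarTower K A A] [SMulCommClass K A A]
      {B : Type*} [Ring B] [Algebra K B] (j : A →ₙₐ[K] B) (_ : Function.Injective j)
      (F : ℕ → Submodule K A) (_ : BCHFactorization.IsCompleteFilteredAlgebra F)
      (P : A →ₗ[K] A) (_ : P ∘ₗ P = P) (_ : ∀ n, ∀ a ∈ F n, P a ∈ F n),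
      BCHFactorization.FactorizationAndUniformization F P (BCHFactorization.hausdorff F)
        (BCHFactorization.expIn F j)) ∧
    -- Lie algebras; the exponentials are taken in the completed enveloping algebra
    (∀ {L : Type*} [LieRing L] [LieAlgebra K L]
      (F : ℕ → Submodule K L) (_ : BCHFactorization.IsCompleteFilteredLieAlgebra F)
      (P : L →ₗ[K] L) (_ : P ∘ₗ P = P) (_ : ∀ n, ∀ a ∈ F n, P a ∈ F n),
      BCHFactorization.FactorizationAndUniformization F P (BCHFactorization.lieHausdorff F)
        (BCHFactorization.lieExp F)) :=
  ⟨fun j hj _ hF _ hPP hP =>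
      BCHFactorization.factorizationAndUniformization_hausdorff hF j hj hPP hP,
    fun _ hF _ hPP hP => BCHFactorization.factorizationAndUniformization_lieHausdorff hF hPP hP⟩
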